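/- **Setting.** A nonempty finite multiset of $n$ elements (pairs of a key and a value, keys from a linear order) is stored in a *lazy search tree*. It is partitioned by rank into nonempty gaps $\Delta_1,\dots,\Delta_m$, and each gap $\Delta_i$ is partitioned by rank into intervals $\mathcal I_{i,1},\dots,\mathcal I_{i,\ell_i}$, whose elements are unordered. Neighbouring gaps, and neighbouring intervals of a gap, are separated by splitting keys. The intervals of a gap lie in an array, split into *left side* and *right side* intervals: if both boundaries of $\Delta_i$ were created by queries, then a left (right) side interval has at most (at least) as many elements of $\Delta_i$ on its left as on its right; if only one boundary was created by a query, all intervals are on that side; if none was, there is only one interval. *Rule (B)* holds in $\Delta_i$ if, whenever $\mathcal I_{i,j}$ and $\mathcal I_{i,j+1}$ are both on the left side, fewer than $|\mathcal I_{i,j}|+|\mathcal I_{i,j+1}|$ elements of $\Delta_i$ lie to the left of $\mathcal I_{i,j}$, and the same, reflected, on the right side. The gaps are stored in a biased search tree in which $\Delta_i$ has weight $|\Delta_i|$: a binary search tree with a level at each node; levels do not increase towards the children and strictly decrease towards a left child; at most 12 nodes follow each other along right children with the same level; a gap of weight $w$ has a level $k$ with $w<2^k$; and the gaps from its last predecessor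 of level $\ge k$ to its first successor of level $\ge k$, both included, have total weight at least $2^{k-1}$. When a weight has grown to $2^k$, its node is lifted one level; when a run of nodes of equal level has become longer than 12, its middle node is lifted one level; rotations restore the order of levels. To insert $e=(k,v)$, find in the biased tree a gap $\Delta_i$ whose range contains $k$; find an interval of $\Delta_i$ whose range contains $k$ by exponential search, outward from the last left side interval and the first right side interval; add $e$ to this interval; and increase the weight of $\Delta_i$ by one, rebalancing the tree as described. Time is the number of elementary steps (comparisons, visits of tree nodes and array cells, list additions). Write $\log x=\max(\log_2 x,1)$. **Theorem (Average-case insert).** 1. Every sequence of nonempty gaps as above can be stored in such a tree. 2. Insertion of any element into a lazy search tree adds the element to one gap whose range contains its key, leaves the other gaps unchanged, and yields a lazy search tree again (Rule (B) is not claimed to persist). 3. There is an absolute constant $C$ such that the following holds for every lazy search tree and every gap $\Delta_i$ of it in which Rule (B) holds. Let a random element be inserted whose key almost surely is such that the element goes into $\Delta_i$, and whose rank amongst the elements of $\Delta_i$ (the number of elements of $\Delta_i$ behind which it is put, with equal keys ordered in any way) is uniformly distributed on $\{0,1,\dots,|\Delta_i|\}$. Then the expected time of the insertion is at most $C\log(n/|\Delta_i|)$,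 where $n$ and $|\Delta_i|$ are the sizes before the insertion. -/

import Mathlib

open MeasureTheory
open scoped ENNReal

namespace LazySearch

universe u v

/-- The logarithm used in all running times: `max (log₂ x) 1`. -/
noncomputable def lg (x : ℝ) : ℝ := max (Real.logb 2 x) 1

/-! ### Conventions on time

Every algorithm below returns a pair consisting of its result and of its running time, counted in
elementary steps: key comparisons, comparisons of stored integers, visits of a tree node or of an
array cell, additions to a linked list. -/

section Searching

/-- Binary search for the least index `t` in `[lo, hi]` with `p t`, where `p` is monotone and
`p hi` is known to hold. One step for each probe. -/
def binarySearch (p : ℕ → Bool) (lo hi : ℕ) : ℕ × ℕ :=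
  if lo < hi then
    if p ((lo + hi) / 2) then
      let s := binarySearch p lo ((lo + hi) / 2)
      (s.1, s.2 + 1)
    else
      let s := binarySearch p ((lo + hi) / 2 + 1) hi
      (s.1, s.2 + 1)
  else (lo, 1)
termination_by hi - lo

/-- Exponential (double binary) search for the least index `t < d` with `p t`, where `p` is monotone
and `p (d - 1)` is known to hold. All indices below `lo` have been excluded; the next probe is
`2 ^ j` cells further on. The search starts with `lo = 0` and `j = 0`. One step for each probe. -/
def expSearch (p : ℕ → Bool) (d lo j : ℕ) : ℕ × ℕ :=
  if lo + 2 ^ j < d then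
    if p (lo + 2 ^ j - 1) then
      let s := binarySearch p lo (lo + 2 ^ j - 1)
      (s.1, s.2 + 1)
    else
      let s := expSearch p d (lo + 2 ^ j) (j + 1)
      (s.1, s.2 + 1)
  else binarySearch p lo (d - 1)
termination_by d - lo
decreasing_by
  have := Nat.two_pow_pos j
  omega

end Searching

/-! ### Intervals and gaps -/

/-- Keys together with `-∞` and `+∞`; splitting keys are taken from here. -/
abbrev Ext (K : Type u) : Type u := WithBot (WithTop K)

/-- A key as an extended key. -/
def ext {K : Type u} (x : K) : Ext K := ((x : WithTop K) : WithBot (WithTop K))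

/-- `Tiles a L b`: the closed ranges in the list `L` follow each other without overlap
(except for common end points) and without holes, from `a` to `b`. -/
def Tiles {K : Type u} [LinearOrder K] : Ext K → List (Ext K × Ext K) → Ext K → Prop
  | a, [], b => a = b
  | a, p :: L, b => p.1 = a ∧ p.1 ≤ p.2 ∧ Tiles p.2 L b

/-- An interval: its two splitting keys and its unordered elements (pairs of a key and a value). -/
structure Interval (K : Type u) (V : Type v) where
  lo : Ext K
  hi : Ext K
  bag : List (K × V)

/-- A gap: its two splitting keys, whether its left (right) boundary was created by a query, the
intervals on its left side and those on its right side (both listed from left to right), and the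
number of its elements. -/
structure Gap (K : Type u) (V : Type v) where
  lo : Ext K
  hi : Ext K
  leftQuery : Bool
  rightQuery : Bool
  left : List (Interval K V)
  right : List (Interval K V)
  size : ℕ

namespace Gap

variable {K : Type u} {V : Type v}

/-- All intervals, from left to right. -/
def intervals (g : Gap K V) : List (Interval K V) := g.left ++ g.right

/-- All elements. -/
def elements (g : Gap K V) : List (K × V) := g.intervals.flatMap Interval.bag

/-- The number of elements in a list of intervals. -/
def count (L : List (Interval K V)) : ℕ := (L.flatMap Interval.bag).length

/-- A well-formed nonempty gap: the intervals partition the gap by rank. -/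
def WellFormed [LinearOrder K] (g : Gap K V) : Prop :=
  0 < g.size ∧ g.size = g.elements.length ∧
  (∀ e ∈ g.elements, g.lo ≤ ext e.1 ∧ ext e.1 ≤ g.hi) ∧
  Tiles ⊥ (g.intervals.map fun I => (I.lo, I.hi)) ⊤ ∧
  ∀ I ∈ g.intervals, ∀ e ∈ I.bag, I.lo ≤ ext e.1 ∧ ext e.1 ≤ I.hi

/-- Rule (A), left and right intervals. Between two query boundaries, an interval is on the left
(right) side if at most (at least) as many elements of the gap lie to its left as to its right.
If only one boundary was created by a query, then all intervals are on that side. Without any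
query there is a single interval. -/
def RuleA (g : Gap K V) : Prop :=
  match g.leftQuery, g.rightQuery with
  | true, true =>
    (∀ A I B, g.left = A ++ I :: B → count A ≤ count (B ++ g.right)) ∧
    (∀ A I B, g.right = A ++ I :: B → count B ≤ count (g.left ++ A))
  | true, false => g.right = []
  | false, true => g.left = []
  | false, false => g.intervals.length = 1

/-- Rule (B) does not call for a merge: for an interval `I` on the left side with next interval `J`
on the left side, fewer than `|I| + |J|` elements of the gap lie to the left of `I`; on the right
side the same, reflected. -/
def RuleB (g : Gap K V) : Prop :=
  (∀ A I J B, g.left = A ++ I :: J :: B → count A < I.bag.length + J.bag.length) ∧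
  (∀ A J I B, g.right = A ++ J :: I :: B → count B < I.bag.length + J.bag.length)

variable [LinearOrder K]

/-- Find an interval for the key `x` by exponential search, outward from the last interval of the
left side and the first interval of the right side. The result is the side (`true` for left) and
the index of the interval on that side, counted outward from the middle. -/
def find (g : Gap K V) (x : K) : (Bool × ℕ) × ℕ :=
  if g.right.isEmpty || g.left.getLast?.any (fun I => ext x ≤ I.hi) then
    let s := expSearch (fun t => g.left.reverse[t]?.any fun I => I.lo ≤ ext x) g.left.length 0 0
    ((true, s.1), s.2 + 1)
  else
    let s := expSearch (fun t => g.right[t]?.any fun I => ext x ≤ I.hi) g.right.length 0 0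
    ((false, s.1), s.2 + 1)

/-- Add an element to an interval. -/
def push (e : K × V) (I : Interval K V) : Interval K V := { I with bag := e :: I.bag }

/-- Insert an element into the interval found by `find`. -/
def insert (g : Gap K V) (e : K × V) : Gap K V × ℕ :=
  let s := g.find e.1
  let g' : Gap K V :=
    if s.1.1 then
      { g with left := (g.left.reverse.modify s.1.2 (push e)).reverse, size := g.size + 1 }
    else
      { g with right := g.right.modify s.1.2 (push e), size := g.size + 1 }
  (g', s.2 + 1)

/-- `r` is a rank of the key `x` amongst the elements of the gap: `x` can be put behind exactly `r`
of them (with equal keys, several values of `r` are possible). -/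
def IsRank (g : Gap K V) (x : K) (r : ℕ) : Prop :=
  g.elements.countP (fun y => y.1 < x) ≤ r ∧ r ≤ g.elements.countP (fun y => y.1 ≤ x)

end Gap

/-! ### The gap data structure: a biased search tree -/

/-- A binary search tree whose nodes carry a level. -/
inductive GapTree (α : Type u) : Type u
  | nil : GapTree α
  | node (level : ℕ) (left : GapTree α) (item : α) (right : GapTree α) : GapTree α

namespace GapTree

section General

variable {α : Type u}

/-- The level of the root; nodes of a biased tree have positive level. -/
def level : GapTree α → ℕ
  | nil => 0
  | node k _ _ _ => k

/-- Levels and items, from left to right. -/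
def entries : GapTree α → List (ℕ × α)
  | nil => []
  | node k l a r => l.entries ++ (k, a) :: r.entries

/-- Items, from left to right. -/
def items (t : GapTree α) : List α := t.entries.map Prod.snd

/-- The number of nodes in the run of the root: the nodes reached from the root by going to the
right as long as the level stays the same. A run plays the role of one multiway node. -/
def runLength : GapTree α → ℕ
  | nil => 0
  | node k _ _ r => if r.level = k then r.runLength + 1 else 1

/-- Levels do not increase from a node to its children, and decrease to a left child. -/
def HeapOrdered : GapTree α → Prop
  | nil => True
  | node k l _ r => l.level < k ∧ r.level ≤ k ∧ l.HeapOrdered ∧ r.HeapOrdered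

/-- No run is longer than `b`. -/
def RunsBounded (b : ℕ) : GapTree α → Prop
  | nil => True
  | node k l a r =>
    (node k l a r).runLength ≤ b ∧ l.RunsBounded b ∧ r.RunsBounded b

/-- The total weight of a list of levels and weights up to and including the first entry whose level
is at least `k`. -/
def reach (k : ℕ) : List (ℕ × ℕ) → ℕ
  | [] => 0
  | (j, w) :: L => if k ≤ j then w else w + reach k L

/-- The largest length of a run. -/
def maxRun : ℕ := 12

/-- A biased tree for the given item weights. An item of weight `w` has a level `k` with `w < 2 ^ k`
(so heavy items are high up), and the items from its last predecessor of level at least `k` to its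
first successor of level at least `k` (both included) have total weight at least `2 ^ k / 2`
(so no item is high up without reason). -/
def Biased (weight : α → ℕ) (t : GapTree α) : Prop :=
  t.HeapOrdered ∧ t.RunsBounded maxRun ∧
  (∀ p ∈ t.entries, weight p.2 < 2 ^ p.1) ∧
  ∀ A k w B, (t.entries.map fun p => (p.1, weight p.2)) = A ++ (k, w) :: B →
    2 ^ k ≤ 2 * (reach k A.reverse + w + reach k B)

/-- Build a node; rotate right if the left child has reached its level. -/
def linkLeft (k : ℕ) (l : GapTree α) (a : α) (r : GapTree α) : GapTree α :=
  match l with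
  | nil => node k nil a r
  | node j l₁ c l₂ => if k ≤ j then node j l₁ c (node k l₂ a r) else node k (node j l₁ c l₂) a r

/-- Build a node; rotate left if the right child has surpassed its level. -/
def linkRight (k : ℕ) (l : GapTree α) (a : α) (r : GapTree α) : GapTree α :=
  match r with
  | nil => node k l a nil
  | node j r₁ c r₂ => if k < j then node j (node k l a r₁) c r₂ else node k l a (node j r₁ c r₂)

/-- Lift node number `i` of the run of the root by one level. -/
def promote : ℕ → GapTree α → GapTree α
  | _, nil => nil
  | 0, node k l a r => node (k + 1) l a r
  | i + 1, node k l a r => linkRight k l a (promote i r)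

/-- If the run of the root has become too long, lift its middle node. The time is that of walking
along the run, once to find its length and once to lift the middle node. -/
def fixRun (t : GapTree α) : GapTree α × ℕ :=
  if maxRun < t.runLength then
    (t.promote (t.runLength / 2), t.runLength + 1 + (t.runLength / 2 + 1))
  else (t, t.runLength + 1)

end General

section Gaps

variable {K : Type u} {V : Type v}

/-- The number `n` of all elements. -/
def total (t : GapTree (Gap K V)) : ℕ := (t.items.map Gap.size).sum

variable [LinearOrder K]

/-- Find the gap for the key `x`. -/
def locate (x : K) : GapTree (Gap K V) → Option (Gap K V) × ℕ
  | nil => (none, 1)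
  | node _ l g r =>
    if ext x < g.lo then
      let s := l.locate x
      (s.1, s.2 + 2)
    else if ext x ≤ g.hi then (some g, 3)
    else
      let s := r.locate x
      (s.1, s.2 + 3)

/-- Store `g'` in place of the gap found for the key `x`, whose size has grown by one, and restore
the balance on the way back to the root. -/
def update (x : K) (g' : Gap K V) : GapTree (Gap K V) → GapTree (Gap K V) × ℕ
  | nil => (nil, 1)
  | node k l g r =>
    if ext x < g.lo then
      let s := l.update x g'
      let c := s.1.fixRun
      (linkLeft k c.1 g r, s.2 + c.2 + 3)
    else if ext x ≤ g.hi then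
      (node (if 2 ^ k ≤ g'.size then k + 1 else k) l g' r, 4)
    else
      let s := r.update x g'
      if s.1.level < k then
        let c := s.1.fixRun
        (linkRight k l g c.1, s.2 + c.2 + 5)
      else (linkRight k l g s.1, s.2 + 5)

/-- Insertion into a lazy search tree: find the gap, find the interval in the gap by exponential
search and add the element to it, and increase the size of the gap in the gap data structure. -/
def insert (t : GapTree (Gap K V)) (e : K × V) : GapTree (Gap K V) × ℕ :=
  let s := t.locate e.1
  match s.1 with
  | none => (t, s.2)
  | some g =>
    let c := g.insert e
    let d := t.update e.1 c.1
    let f := d.1.fixRun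
    (f.1, s.2 + c.2 + d.2 + f.2)

end Gaps

end GapTree

variable {K : Type u} {V : Type v} [LinearOrder K]

/-- A sequence of gaps that partitions the elements by rank, from left to right. -/
def IsGapSequence (gs : List (Gap K V)) : Prop :=
  Tiles ⊥ (gs.map fun g => (g.lo, g.hi)) ⊤ ∧ ∀ g ∈ gs, g.WellFormed

/-- A lazy search tree: a biased search tree on a sequence of gaps, the weight of a gap being the
number of its elements. -/
def IsLazySearchTree (t : GapTree (Gap K V)) : Prop :=
  IsGapSequence t.items ∧ t.Biased Gap.size

end LazySearch

/-! The time splits into a walk in the biased tree and a search inside the gap.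

Tree. On the way from the root, every move stays in a run of at most 12 nodes of one level or lowers
the level, so reaching a gap of level `k` takes at most `12 * (level - k) + runLength` nodes, each
of constant cost (`locate_update_cost`). The heavy window of the root gives `2 ^ level ≤ 2 * n`, and
the gap has size below `2 ^ k`. Hence the level difference is at most `lg (n / size) + 1`
(`level_sub_le`).

Gap. Exponential search that ends at index `i` costs at most `2 * i + 2`. This linear bound
suffices: Rule (B) makes the number of elements at least double with every second interval from the
outer end towards the middle, so intervals far from the middle contain few ranks. Summing the index
over all ranks and exchanging the sums gives at most `8 * (size + 1)` (`sum_rankCost_le`); under a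
uniform rank the mean index is at most 8.

Invariants. Lifting an item is harmful only through windows: its own must be twice as heavy, and
windows of items one level higher now stop at it. Both demands hold if the item, together with lower
or equal items next to it, weighs `2 ^ k` towards each side (`WindowsHeavy.raise`). An item whose
own weight has reached `2 ^ k` satisfies this. So does the middle of a run of 13, because six items
of level `k` contain two disjoint triples, and the window of the middle of a triple lies inside the
triple (`WindowsHeavy.raise_middle`). The shape of a subtree during repair is controlled by
`Updated`, which survives each rotation.

Existence. Levels `log₂ w + 1` have heavy windows from the start; lifting middles of long runs
terminates because heavy windows bound all levels. -/

namespace LazySearch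

universe u v

/-! ### Binary and exponential search -/

theorem binarySearch_spec (p : ℕ → Bool) (lo hi : ℕ) (h : lo ≤ hi) (hp : p hi)
    (hl : lo = 0 ∨ p (lo - 1) = false) :
    lo ≤ (binarySearch p lo hi).1 ∧ (binarySearch p lo hi).1 ≤ hi ∧
      p (binarySearch p lo hi).1 ∧
      ((binarySearch p lo hi).1 = 0 ∨ p ((binarySearch p lo hi).1 - 1) = false) := by
  fun_induction binarySearch p lo hi with
  | case1 lo hi hlt hm s ih =>
    obtain ⟨h1, h2, h3⟩ := ih (by omega) hm hl
    exact ⟨h1, h2.trans (by omega), h3⟩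
  | case2 lo hi hlt hm s ih =>
    obtain ⟨h1, h2⟩ := ih (by omega) hp (Or.inr (by simpa using hm))
    exact ⟨le_trans (by omega) h1, h2⟩
  | case3 lo hi hlt =>
    obtain rfl : lo = hi := by omega
    exact ⟨le_rfl, le_rfl, hp, hl⟩

theorem binarySearch_cost (p : ℕ → Bool) (lo hi j : ℕ) (h : hi - lo < 2 ^ j) :
    (binarySearch p lo hi).2 ≤ j + 1 := by
  fun_induction binarySearch p lo hi generalizing j with
  | case1 lo hi hlt hm s ih =>
    cases j with
    | zero => omega
    | succ j => have := ih j (by rw [pow_succ] at h; omega); simpa using this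
  | case2 lo hi hlt hm s ih =>
    cases j with
    | zero => omega
    | succ j => have := ih j (by rw [pow_succ] at h; omega); simpa using this
  | case3 lo hi hlt => simp

theorem expSearch_spec (p : ℕ → Bool) (d lo j : ℕ) (h : lo < d) (hp : p (d - 1))
    (hl : lo = 0 ∨ p (lo - 1) = false) :
    lo ≤ (expSearch p d lo j).1 ∧ (expSearch p d lo j).1 < d ∧ p (expSearch p d lo j).1 ∧
      ((expSearch p d lo j).1 = 0 ∨ p ((expSearch p d lo j).1 - 1) = false) := by
  fun_induction expSearch p d lo j with
  | case1 lo j hlt hm s =>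
    have h2 := Nat.two_pow_pos j
    obtain ⟨h3, h4, h5⟩ := binarySearch_spec p lo (lo + 2 ^ j - 1) (by omega) hm hl
    exact ⟨h3, h4.trans_lt (by omega), h5⟩
  | case2 lo j hlt hm s ih =>
    obtain ⟨h3, h4⟩ := ih hlt (Or.inr (by simpa using hm))
    exact ⟨(Nat.le_add_right _ _).trans h3, h4⟩
  | case3 lo j hlt =>
    have := binarySearch_spec p lo (d - 1) (by omega) hp hl
    exact ⟨this.1, by omega, this.2.2⟩

/-- With `lo + 1 = 2 ^ j`, a final binary search costs at most `j + 1` and there is at most one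
further probe. The sum with `j` is at most `2 * j + 2 ≤ 2 * lo + 2`, and the result is at least
`lo`. A failed probe is paid for by the increase of `j`. -/
theorem expSearch_cost (p : ℕ → Bool) (d lo j : ℕ) (h : lo < d) (hp : p (d - 1))
    (hl : lo = 0 ∨ p (lo - 1) = false) (hj : lo + 1 = 2 ^ j) :
    (expSearch p d lo j).2 + j ≤ 2 * (expSearch p d lo j).1 + 2 := by
  have h3 : j < 2 ^ j := Nat.lt_two_pow_self
  fun_induction expSearch p d lo j with
  | case1 lo j hlt hm s =>
    have h1 := binarySearch_spec p lo (lo + 2 ^ j - 1) (by omega) hm hl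
    have h2 := binarySearch_cost p lo (lo + 2 ^ j - 1) j (by omega)
    simp only [s]
    omega
  | case2 lo j hlt hm s ih =>
    have := ih hlt (Or.inr (by simpa using hm)) (by rw [pow_succ]; omega) Nat.lt_two_pow_self
    simp only [s]
    omega
  | case3 lo j hlt =>
    have h1 := binarySearch_spec p lo (d - 1) (by omega) hp hl
    have h2 := binarySearch_cost p lo (d - 1) j (by omega)
    omega

theorem modify_append_cons {α : Type u} (f : α → α) (A : List α) (a : α) (B : List α) :
    (A ++ a :: B).modify A.length f = A ++ f a :: B := by
  induction A with
  | nil => simp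
  | cons b A ih => simpa using ih

/-! ### Ranges that tile the line of extended keys -/

section Tiles

variable {K : Type u} [LinearOrder K]

theorem tiles_append {a b : Ext K} {L M : List (Ext K × Ext K)} :
    Tiles a (L ++ M) b ↔ ∃ c, Tiles a L c ∧ Tiles c M b := by
  induction L generalizing a with
  | nil => simp [Tiles]
  | cons p L ih =>
    simp only [List.cons_append, Tiles, ih]
    constructor
    · rintro ⟨h1, h2, c, h3, h4⟩
      exact ⟨c, ⟨h1, h2, h3⟩, h4⟩
    · rintro ⟨c, ⟨h1, h2, h3⟩, h4⟩
      exact ⟨h1, h2, c, h3, h4⟩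

theorem Tiles.le {a b : Ext K} {L : List (Ext K × Ext K)} (h : Tiles a L b) : a ≤ b := by
  induction L generalizing a with
  | nil => exact le_of_eq h
  | cons p L ih => exact h.1 ▸ h.2.1.trans (ih h.2.2)

theorem Tiles.bounds {a b : Ext K} {L : List (Ext K × Ext K)} (h : Tiles a L b)
    {p : Ext K × Ext K} (hp : p ∈ L) : a ≤ p.1 ∧ p.1 ≤ p.2 ∧ p.2 ≤ b := by
  obtain ⟨A, B, rfl⟩ := List.append_of_mem hp
  obtain ⟨c, h1, h2, h3, h4⟩ := tiles_append.1 h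
  exact ⟨h2 ▸ h1.le, h3, h4.le⟩

theorem bot_lt_ext (x : K) : (⊥ : Ext K) < ext x := WithBot.bot_lt_coe _

theorem ext_lt_ext {x y : K} : ext x < ext y ↔ x < y := by
  simp [ext]

end Tiles

/-! ### Search and insertion inside one gap -/

namespace Gap

variable {K : Type u} {V : Type v}

theorem count_append (L M : List (Interval K V)) : count (L ++ M) = count L + count M := by
  simp [count]

theorem count_cons (I : Interval K V) (L : List (Interval K V)) :
    count (I :: L) = I.bag.length + count L := by
  simp [count]

theorem count_reverse (L : List (Interval K V)) : count L.reverse = count L := by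
  simp only [count]
  exact ((List.reverse_perm L).flatMap_right _).length_eq

variable [LinearOrder K]

/-- The outcome of `find`: an interval whose range contains the key, with index `i` outward from
the middle; if `i` is positive, the key lies strictly beyond the intervals nearer to the middle. -/
theorem find_spec (g : Gap K V)
    (hT : Tiles ⊥ (g.intervals.map fun I => (I.lo, I.hi)) ⊤) (x : K) :
    ∃ I A B, I.lo ≤ ext x ∧ ext x ≤ I.hi ∧ (g.find x).2 ≤ 2 * (g.find x).1.2 + 3 ∧
      (((g.find x).1.1 = true ∧ g.left = A ++ I :: B ∧ (g.find x).1.2 = B.length ∧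
          (B ≠ [] → ∀ J ∈ B ++ g.right, ext x < J.lo)) ∨
        ((g.find x).1.1 = false ∧ g.right = A ++ I :: B ∧ (g.find x).1.2 = A.length ∧
          (A ≠ [] → ∀ J ∈ g.left ++ A, J.hi < ext x))) := by
  simp only [intervals, List.map_append] at hT
  obtain ⟨c, hT1, hT2⟩ := tiles_append.1 hT
  unfold find
  split_ifs with hc
  · dsimp only
    set p : ℕ → Bool := fun t => g.left.reverse[t]?.any fun I => decide (I.lo ≤ ext x) with hpdef
    have hne : g.left ≠ [] := by
      intro h0
      rw [h0] at hc hT1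
      have hr : g.right = [] := by simpa using hc
      rw [hr] at hT2
      have h1 : (⊥ : Ext K) = c := hT1
      have h2 : c = ⊤ := hT2
      exact absurd (h1.trans h2) (by simp)
    have hpos : 0 < g.left.length := List.length_pos_iff.2 hne
    have hp : p (g.left.length - 1) := by
      obtain ⟨J, L, hL⟩ := List.exists_cons_of_ne_nil hne
      have : J.lo = ⊥ := by rw [hL] at hT1; exact hT1.1
      simp [hpdef, hL, this]
    obtain ⟨-, h2, h3, h4⟩ := expSearch_spec p _ 0 0 hpos hp (Or.inl rfl)
    have h5 := expSearch_cost p _ 0 0 hpos hp (Or.inl rfl) rfl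
    set i := (expSearch p g.left.length 0 0).1
    have hi : i < g.left.reverse.length := by simpa using h2
    have hsplit := List.take_append_drop i g.left.reverse
    rw [List.drop_eq_getElem_cons hi] at hsplit
    set I := g.left.reverse[i]
    set B := (g.left.reverse.take i).reverse
    set A := (g.left.reverse.drop (i + 1)).reverse
    have hB : B.length = i := by simp [B]; omega
    have hl : g.left = A ++ I :: B := by
      have := congrArg List.reverse hsplit
      simpa [A, B] using this.symm
    have hI : I.lo ≤ ext x := by
      have : p i = decide (I.lo ≤ ext x) := by simp [hpdef, I, List.getElem?_eq_getElem hi]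
      rw [this] at h3
      simpa using h3
    rw [hl, List.map_append, List.map_cons] at hT1
    obtain ⟨c1, -, hT3, hT4, hT5⟩ := tiles_append.1 hT1
    have key : ext x ≤ I.hi ∧ (B ≠ [] → ∀ J ∈ B ++ g.right, ext x < J.lo) := by
      rcases hBc : B with _ | ⟨J, B'⟩
      · refine ⟨?_, fun h => absurd rfl h⟩
        rw [hBc] at hT5 hl
        have hT5 : I.hi = c := hT5
        simp only [Bool.or_eq_true, List.isEmpty_iff] at hc
        rcases hc with hc | hc
        · rw [hc] at hT2
          have hT2 : c = ⊤ := hT2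
          rw [hT5, hT2]
          exact le_top
        · rw [hl] at hc
          simpa using hc
      -- For `i > 0` the cell just before the result was rejected, which gives a strict inequality;
      -- tiling carries it to everything nearer the middle and beyond. For `i = 0` nothing was
      -- rejected, and the key may equal a splitting key.
      · have hi0 : i ≠ 0 := by rw [← hB, hBc]; simp
        have h6 : p (i - 1) = false := h4.resolve_left hi0
        have h7 : g.left.reverse[i - 1]? = some J := by
          have : g.left.reverse = B'.reverse ++ J :: I :: A.reverse := by
            rw [hl, hBc]; simp
          rw [this, ← hB, hBc]
          simp
        have h8 : ext x < J.lo := by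
          simpa [hpdef, h7] using h6
        rw [hBc] at hT5
        have h9 : J.lo = I.hi := hT5.1
        refine ⟨h9 ▸ h8.le, fun _ M hM => h8.trans_le ?_⟩
        have hT6 : Tiles I.hi (((J :: B') ++ g.right).map fun I => (I.lo, I.hi)) ⊤ := by
          rw [List.map_append]
          exact tiles_append.2 ⟨c, hT5, hT2⟩
        rw [h9]
        exact (hT6.bounds (List.mem_map.2 ⟨M, hM, rfl⟩)).1
    exact ⟨I, A, B, hI, key.1, by omega, Or.inl ⟨rfl, hl, hB.symm, key.2⟩⟩
  · dsimp only
    set p : ℕ → Bool := fun t => g.right[t]?.any fun I => decide (ext x ≤ I.hi) with hpdef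
    simp only [Bool.or_eq_true, List.isEmpty_iff, not_or] at hc
    obtain ⟨hne, hlast⟩ := hc
    have hpos : 0 < g.right.length := List.length_pos_iff.2 hne
    have hp : p (g.right.length - 1) := by
      obtain ⟨L, J, hL⟩ := List.eq_nil_or_concat g.right |>.resolve_left hne
      have : J.hi = ⊤ := by
        rw [hL, List.concat_eq_append, List.map_append] at hT2
        obtain ⟨c1, -, -, -, h⟩ := tiles_append.1 hT2
        exact h
      simp [hpdef, hL, this]
    obtain ⟨-, h2, h3, h4⟩ := expSearch_spec p _ 0 0 hpos hp (Or.inl rfl)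
    have h5 := expSearch_cost p _ 0 0 hpos hp (Or.inl rfl) rfl
    set i := (expSearch p g.right.length 0 0).1
    have hsplit := List.take_append_drop i g.right
    rw [List.drop_eq_getElem_cons h2] at hsplit
    set I := g.right[i]
    set A := g.right.take i
    set B := g.right.drop (i + 1)
    have hA : A.length = i := by simp [A]; omega
    have hr : g.right = A ++ I :: B := hsplit.symm
    have hI : ext x ≤ I.hi := by
      have : p i = decide (ext x ≤ I.hi) := by simp [hpdef, I, List.getElem?_eq_getElem h2]
      rw [this] at h3
      simpa using h3
    rw [hr, List.map_append, List.map_cons] at hT2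
    obtain ⟨c1, hT3, hT4, hT5⟩ := tiles_append.1 hT2
    have hT4 : I.lo = c1 := hT4
    have key : I.lo ≤ ext x ∧ (A ≠ [] → ∀ J ∈ g.left ++ A, J.hi < ext x) := by
      rcases List.eq_nil_or_concat A with hAc | ⟨A', J, hAc⟩
      · refine ⟨?_, fun h => absurd hAc h⟩
        rw [hAc] at hT3
        have hT3 : c = c1 := hT3
        rw [hT4, ← hT3]
        rcases List.eq_nil_or_concat g.left with h0 | ⟨L, J, h0⟩
        · rw [h0] at hT1
          have hT1 : (⊥ : Ext K) = c := hT1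
          rw [← hT1]
          exact bot_le
        · rw [h0] at hlast
          rw [h0, List.concat_eq_append, List.map_append] at hT1
          obtain ⟨c2, -, -, -, h⟩ := tiles_append.1 hT1
          have h : J.hi = c := h
          rw [← h]
          simp at hlast
          exact hlast.le
      · rw [List.concat_eq_append] at hAc
        have hi0 : i ≠ 0 := by rw [← hA, hAc]; simp
        have h6 : p (i - 1) = false := h4.resolve_left hi0
        have h7 : g.right[i - 1]? = some J := by
          rw [hr, ← hA, hAc]
          simp
        have h8 : J.hi < ext x := by
          simpa [hpdef, h7] using h6
        have h9 : J.hi = c1 := by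
          rw [hAc, List.map_append] at hT3
          obtain ⟨c2, -, -, -, h⟩ := tiles_append.1 hT3
          exact h
        refine ⟨hT4 ▸ h9 ▸ h8.le, fun _ M hM => lt_of_le_of_lt ?_ h8⟩
        have hT6 : Tiles ⊥ ((g.left ++ A).map fun I => (I.lo, I.hi)) c1 := by
          rw [List.map_append]
          exact tiles_append.2 ⟨c, hT1, hT3⟩
        rw [h9]
        exact (hT6.bounds (List.mem_map.2 ⟨M, hM, rfl⟩)).2.2
    exact ⟨I, A, B, key.1, hI, by omega, Or.inr ⟨rfl, hr, hA.symm, key.2⟩⟩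

theorem insert_spec (g : Gap K V)
    (hT : Tiles ⊥ (g.intervals.map fun I => (I.lo, I.hi)) ⊤) (e : K × V) :
    ∃ I A B, I.lo ≤ ext e.1 ∧ ext e.1 ≤ I.hi ∧ g.intervals = A ++ I :: B ∧
      (g.insert e).1.intervals = A ++ push e I :: B ∧ (g.insert e).1.size = g.size + 1 ∧
      (g.insert e).1.lo = g.lo ∧ (g.insert e).1.hi = g.hi := by
  obtain ⟨I, A, B, h1, h2, -, h | h⟩ := g.find_spec hT e.1
  · obtain ⟨hf, hl, hi, -⟩ := h
    refine ⟨I, A, B ++ g.right, h1, h2, by simp [intervals, hl], ?_⟩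
    have hm : (g.left.reverse.modify (g.find e.1).1.2 (push e)).reverse
        = A ++ push e I :: B := by
      rw [hi, hl]
      have : (A ++ I :: B).reverse = B.reverse ++ I :: A.reverse := by simp
      rw [this, ← List.length_reverse, modify_append_cons]
      simp
    simp [insert, hf, intervals, hm]
  · obtain ⟨hf, hr, hi, -⟩ := h
    refine ⟨I, g.left ++ A, B, h1, h2, by simp [intervals, hr], ?_⟩
    have hm : g.right.modify (g.find e.1).1.2 (push e) = A ++ push e I :: B := by
      rw [hi, hr, modify_append_cons]
    simp [insert, hf, intervals, hm]

theorem insert_elements_perm (g : Gap K V)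
    (hT : Tiles ⊥ (g.intervals.map fun I => (I.lo, I.hi)) ⊤) (e : K × V) :
    (g.insert e).1.elements.Perm (e :: g.elements) := by
  obtain ⟨I, A, B, -, -, h3, h4, -⟩ := g.insert_spec hT e
  simp only [elements, h3, h4, List.flatMap_append, List.flatMap_cons, push, List.cons_append]
  exact List.perm_middle

theorem WellFormed.insert {g : Gap K V} (h : g.WellFormed) (e : K × V)
    (hlo : g.lo ≤ ext e.1) (hhi : ext e.1 ≤ g.hi) : (g.insert e).1.WellFormed := by
  obtain ⟨h1, h2, h3, h4, h5⟩ := h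
  have hp := g.insert_elements_perm h4 e
  obtain ⟨I, A, B, k1, k2, k3, k4, k5, k6, k7⟩ := g.insert_spec h4 e
  refine ⟨by omega, by rw [k5, hp.length_eq, h2]; simp, ?_, ?_, ?_⟩
  · intro y hy
    rw [k6, k7]
    rcases List.mem_cons.1 (hp.mem_iff.1 hy) with rfl | hy
    · exact ⟨hlo, hhi⟩
    · exact h3 y hy
  · rw [k4]
    rw [k3] at h4
    simpa [push] using h4
  · intro J hJ
    rw [k4] at hJ
    rw [k3] at h5
    rcases List.mem_append.1 hJ with hJ | hJ
    · exact h5 J (by simp [hJ])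
    · rcases List.mem_cons.1 hJ with rfl | hJ
      · intro y hy
        rcases List.mem_cons.1 hy with rfl | hy
        · exact ⟨k1, k2⟩
        · exact h5 I (by simp) y hy
      · exact h5 J (by simp [hJ])

end Gap

namespace GapTree

/-! ### Heavy windows in lists of levels and weights -/

section Windows

/-- The total weight of a list of levels and weights. -/
def weightSum (L : List (ℕ × ℕ)) : ℕ := (L.map Prod.snd).sum

@[simp] theorem weightSum_nil : weightSum [] = 0 := rfl

@[simp] theorem weightSum_cons (p : ℕ × ℕ) (L : List (ℕ × ℕ)) :
    weightSum (p :: L) = p.2 + weightSum L := by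
  simp [weightSum]

@[simp] theorem weightSum_append (L M : List (ℕ × ℕ)) :
    weightSum (L ++ M) = weightSum L + weightSum M := by
  simp [weightSum]

@[simp] theorem weightSum_reverse (L : List (ℕ × ℕ)) : weightSum L.reverse = weightSum L := by
  simp [weightSum, List.sum_reverse]

/-- The window of each item of level `k` has total weight at least `2 ^ k / 2`. -/
def WindowsHeavy (L : List (ℕ × ℕ)) : Prop :=
  ∀ A k w B, L = A ++ (k, w) :: B → 2 ^ k ≤ 2 * (reach k A.reverse + w + reach k B)

theorem WindowsHeavy.reverse {L : List (ℕ × ℕ)} (h : WindowsHeavy L) :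
    WindowsHeavy L.reverse := by
  intro A k w B hL
  have := h B.reverse k w A.reverse (by rw [← List.reverse_reverse L, hL]; simp)
  simp only [List.reverse_reverse] at this
  omega

theorem reach_le (k : ℕ) (L : List (ℕ × ℕ)) : reach k L ≤ weightSum L := by
  induction L with
  | nil => simp [reach]
  | cons p L ih =>
    simp only [reach, weightSum_cons]
    split_ifs <;> omega

theorem reach_append_of_exists {k : ℕ} {M : List (ℕ × ℕ)} (h : ∃ p ∈ M, k ≤ p.1)
    (L : List (ℕ × ℕ)) : reach k (M ++ L) = reach k M := by
  induction M with
  | nil => simp at h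
  | cons p M ih =>
    simp only [List.cons_append, reach]
    split_ifs with hp
    · rfl
    · rw [ih]
      simpa [hp] using h

theorem reach_append_of_forall {k : ℕ} {M : List (ℕ × ℕ)} (h : ∀ p ∈ M, p.1 < k)
    (L : List (ℕ × ℕ)) : reach k (M ++ L) = weightSum M + reach k L := by
  induction M with
  | nil => simp
  | cons p M ih =>
    simp only [List.cons_append, reach, weightSum_cons]
    rw [if_neg (by simpa using h p (by simp)), ih fun q hq => h q (by simp [hq])]
    omega

/-- The left half of raising an item: the windows of items to its left stay heavy. -/
theorem WindowsHeavy.raise_left {X Y X₁ X₂ : List (ℕ × ℕ)} {k w w' : ℕ} (hw : w ≤ w')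
    (h : WindowsHeavy (X ++ (k, w) :: Y)) (hX : X = X₁ ++ X₂) (hX₂ : ∀ p ∈ X₂, p.1 ≤ k)
    (hs : 2 ^ k ≤ w' + weightSum X₂) {A B : List (ℕ × ℕ)} {j v : ℕ} (hA : X = A ++ (j, v) :: B) :
    2 ^ j ≤ 2 * (reach j A.reverse + v + reach j (B ++ (k + 1, w') :: Y)) := by
  have h0 := h A j v (B ++ (k, w) :: Y) (by rw [hA]; simp)
  by_cases hB : ∃ p ∈ B, j ≤ p.1
  · rw [reach_append_of_exists hB] at h0 ⊢
    exact h0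
  · push Not at hB
    rw [reach_append_of_forall hB] at h0 ⊢
    simp only [reach] at h0 ⊢
    -- Only windows of level exactly `k + 1` shrink: lower ones already stopped at the raised item,
    -- higher ones still pass it.
    rcases lt_trichotomy j (k + 1) with hj | rfl | hj
    · rw [if_pos (by omega)] at h0 ⊢
      omega
    -- An item of level `k + 1` cannot lie in `X₂`, so all of `X₂` lies between it and the raised
    -- item.
    · have : weightSum X₂ ≤ weightSum B := by
        rw [hX] at hA
        rcases List.append_eq_append_iff.1 hA with ⟨C, hC1, hC2⟩ | ⟨C, hC1, hC2⟩
        · have := hX₂ (k + 1, v) (by rw [hC2]; simp)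
          simp at this
        · rcases C with _ | ⟨c, C⟩
          · have := hX₂ (k + 1, v) (by simp at hC2; rw [← hC2]; simp)
            simp at this
          · simp only [List.cons_append, List.cons.injEq] at hC2
            rw [hC2.2]
            simp
      rw [if_pos le_rfl, pow_succ]
      omega
    · rw [if_neg (by omega)] at h0 ⊢
      omega

/-- The raised item has `X₂` and `Y₁` inside its new window. Items to its left are handled by
`raise_left`, those to its right by the same lemma for the reversed list. -/
theorem WindowsHeavy.raise {X Y X₁ X₂ Y₁ Y₂ : List (ℕ × ℕ)} {k w w' : ℕ} (hw : w ≤ w')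
    (h : WindowsHeavy (X ++ (k, w) :: Y)) (hX : X = X₁ ++ X₂) (hX₂ : ∀ p ∈ X₂, p.1 ≤ k)
    (hXs : 2 ^ k ≤ w' + weightSum X₂) (hY : Y = Y₁ ++ Y₂) (hY₁ : ∀ p ∈ Y₁, p.1 ≤ k)
    (hYs : 2 ^ k ≤ w' + weightSum Y₁) :
    WindowsHeavy (X ++ (k + 1, w') :: Y) := by
  intro A j v B hL
  rcases List.append_eq_append_iff.1 hL with ⟨C, hC1, hC2⟩ | ⟨C, hC1, hC2⟩
  · rcases C with _ | ⟨c, C⟩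
    · simp only [List.nil_append, List.cons.injEq, Prod.mk.injEq] at hC2
      obtain ⟨⟨rfl, rfl⟩, rfl⟩ := hC2
      simp only [List.append_nil] at hC1
      subst hC1
      rw [hX, hY, List.reverse_append, reach_append_of_forall, reach_append_of_forall, weightSum_reverse]
      · rw [pow_succ] at *; omega
      · intro p hp; have := hY₁ p hp; omega
      · intro p hp; have := hX₂ p (List.mem_reverse.1 hp); omega
    · simp only [List.cons_append, List.cons.injEq] at hC2
      obtain ⟨rfl, rfl⟩ := hC2
      have h1 : WindowsHeavy ((C ++ (j, v) :: B).reverse ++ (k, w) :: X.reverse) := by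
        have := h.reverse
        simpa using this
      have := h1.raise_left (X₁ := Y₂.reverse) (X₂ := Y₁.reverse) (w' := w') hw (by rw [hY]; simp)
        (fun p hp => hY₁ p (List.mem_reverse.1 hp)) (by simpa using hYs)
        (A := B.reverse) (B := C.reverse) (j := j) (v := v) (by simp)
      rw [hC1]
      simp only [List.reverse_reverse, List.reverse_append, List.reverse_cons, List.append_assoc,
        List.cons_append, List.nil_append] at this ⊢
      omega
  · rcases C with _ | ⟨c, C⟩
    · simp only [List.nil_append, List.cons.injEq, Prod.mk.injEq] at hC2
      obtain ⟨⟨rfl, rfl⟩, rfl⟩ := hC2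
      simp only [List.append_nil] at hC1
      subst hC1
      rw [hX, hY, List.reverse_append, reach_append_of_forall, reach_append_of_forall, weightSum_reverse]
      · rw [pow_succ] at *; omega
      · intro p hp; have := hY₁ p hp; omega
      · intro p hp; have := hX₂ p (List.mem_reverse.1 hp); omega
    · simp only [List.cons_append, List.cons.injEq] at hC2
      obtain ⟨rfl, rfl⟩ := hC2
      exact h.raise_left hw hX hX₂ hXs hC1

theorem reach_mono {A A' : List (ℕ × ℕ)} {j w w' : ℕ} (hw : w ≤ w') (k : ℕ) :
    reach k (A ++ (j, w) :: A') ≤ reach k (A ++ (j, w') :: A') := by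
  induction A with
  | nil => simp only [List.nil_append, reach]; split_ifs <;> omega
  | cons p A ih => simp only [List.cons_append, reach]; split_ifs <;> omega

theorem WindowsHeavy.mono {X Y : List (ℕ × ℕ)} {k w w' : ℕ} (hw : w ≤ w')
    (h : WindowsHeavy (X ++ (k, w) :: Y)) : WindowsHeavy (X ++ (k, w') :: Y) := by
  intro A j v B hL
  rcases List.append_eq_append_iff.1 hL with ⟨C, rfl, hC2⟩ | ⟨C, rfl, hC2⟩
  · rcases C with _ | ⟨c, C⟩
    · simp only [List.nil_append, List.cons.injEq, Prod.mk.injEq] at hC2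
      obtain ⟨⟨rfl, rfl⟩, rfl⟩ := hC2
      have := h X k w Y rfl
      simp only [List.append_nil]
      omega
    · simp only [List.cons_append, List.cons.injEq] at hC2
      obtain ⟨rfl, rfl⟩ := hC2
      have h1 := h (X ++ (k, w) :: C) j v B (by simp)
      have h2 := reach_mono (A := C.reverse) (A' := X.reverse) (j := k) hw j
      simp only [List.reverse_append, List.reverse_cons, List.append_assoc, List.cons_append,
        List.nil_append] at h1 h2 ⊢
      omega
  · rcases C with _ | ⟨c, C⟩
    · simp only [List.nil_append, List.cons.injEq, Prod.mk.injEq] at hC2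
      obtain ⟨⟨rfl, rfl⟩, rfl⟩ := hC2
      have := h A j w B (by simp)
      omega
    · simp only [List.cons_append, List.cons.injEq] at hC2
      obtain ⟨rfl, rfl⟩ := hC2
      have h1 := h A j v (C ++ (k, w) :: Y) (by simp)
      have h2 := reach_mono (A := C) (A' := Y) (j := k) hw j
      omega

/-- The window of `(k, w)` is stopped inside `M₁` and inside `M₂`, so it does not leave the block.
-/
theorem WindowsHeavy.three {X Y M₁ M₂ : List (ℕ × ℕ)} {k w : ℕ}
    (h : WindowsHeavy (X ++ (M₁ ++ (k, w) :: M₂) ++ Y)) (h₁ : ∃ p ∈ M₁, k ≤ p.1)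
    (h₂ : ∃ p ∈ M₂, k ≤ p.1) : 2 ^ k ≤ 2 * weightSum (M₁ ++ (k, w) :: M₂) := by
  have := h (X ++ M₁) k w (M₂ ++ Y) (by simp)
  rw [List.reverse_append, reach_append_of_exists (by simpa using h₁),
    reach_append_of_exists h₂] at this
  have h3 := reach_le k M₁.reverse
  have h4 := reach_le k M₂
  simp only [weightSum_append, weightSum_cons, weightSum_reverse] at *
  omega

theorem exists_split_of_lt_countP {α : Type u} (p : α → Bool) (n : ℕ) {M : List α}
    (h : n < M.countP p) :
    ∃ A a B, M = A ++ a :: B ∧ p a ∧ A.countP p = n ∧ B.countP p + n + 1 = M.countP p := by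
  induction M generalizing n with
  | nil => simp at h
  | cons b M ih =>
    by_cases hb : p b
    · rw [List.countP_cons_of_pos hb] at h ⊢
      cases n with
      | zero => exact ⟨[], b, M, rfl, hb, rfl, rfl⟩
      | succ n =>
        obtain ⟨A, a, B, rfl, h1, h2, h3⟩ := ih n (by omega)
        exact ⟨b :: A, a, B, rfl, h1, by rw [List.countP_cons_of_pos hb, h2], by omega⟩
    · rw [List.countP_cons_of_neg hb] at h ⊢
      obtain ⟨A, a, B, rfl, h1, h2, h3⟩ := ih n h
      exact ⟨b :: A, a, B, rfl, h1, by rw [List.countP_cons_of_neg hb, h2], h3⟩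

theorem WindowsHeavy.of_three_le {X Y M : List (ℕ × ℕ)} {k : ℕ}
    (h : WindowsHeavy (X ++ M ++ Y)) (hM : 3 ≤ M.countP fun p => p.1 == k) :
    2 ^ k ≤ 2 * weightSum M := by
  obtain ⟨A, ⟨j, w⟩, B, rfl, h1, h2, h3⟩ := exists_split_of_lt_countP (fun p => p.1 == k) 1
    (M := M) (by omega)
  obtain rfl : j = k := by simpa using h1
  have aux : ∀ L : List (ℕ × ℕ), 0 < L.countP (fun p => p.1 == j) → ∃ p ∈ L, j ≤ p.1 := by
    intro L hL
    obtain ⟨p, hp, hpj⟩ := List.countP_pos_iff.1 hL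
    exact ⟨p, hp, by simp at hpj; omega⟩
  exact h.three (aux _ (by omega)) (aux _ (by omega))

/-- Two disjoint windows fit into six items of level `k`. -/
theorem WindowsHeavy.of_six_le {X Y M : List (ℕ × ℕ)} {k : ℕ}
    (h : WindowsHeavy (X ++ M ++ Y)) (hM : 6 ≤ M.countP fun p => p.1 == k) :
    2 ^ k ≤ weightSum M := by
  obtain ⟨A, a, B, rfl, h1, h2, h3⟩ := exists_split_of_lt_countP (fun p => p.1 == k) 3
    (M := M) (by omega)
  have hA := WindowsHeavy.of_three_le (X := X) (M := A) (Y := a :: B ++ Y) (k := k)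
    (by simpa using h) (by omega)
  have hB := WindowsHeavy.of_three_le (X := X ++ A) (M := a :: B) (Y := Y) (k := k)
    (by simpa using h) (by rw [List.countP_cons_of_pos (by exact h1)]; omega)
  simp only [weightSum_append] at *
  omega

/-- An item with six items of its own level on both sides can be raised. -/
theorem WindowsHeavy.raise_middle {A X Y B : List (ℕ × ℕ)} {k w : ℕ}
    (h : WindowsHeavy (A ++ (X ++ (k, w) :: Y) ++ B)) (hX : ∀ p ∈ X, p.1 ≤ k)
    (hY : ∀ p ∈ Y, p.1 ≤ k) (hXc : 6 ≤ X.countP fun p => p.1 == k)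
    (hYc : 6 ≤ Y.countP fun p => p.1 == k) :
    WindowsHeavy (A ++ (X ++ (k + 1, w) :: Y) ++ B) := by
  have h1 := WindowsHeavy.of_six_le (X := A) (M := X) (Y := (k, w) :: Y ++ B) (by simpa using h) hXc
  have h2 := WindowsHeavy.of_six_le (X := A ++ X ++ [(k, w)]) (M := Y) (Y := B)
    (by simpa using h) hYc
  have := WindowsHeavy.raise (X := A ++ X) (Y := Y ++ B) (k := k) (w := w) le_rfl (by simpa using h)
    rfl hX (by omega) rfl hY (by omega)
  simpa using this

end Windows

/-! ### Repair of runs and rotations -/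

section General

variable {α : Type u}

@[simp] theorem entries_linkLeft (k : ℕ) (l : GapTree α) (a : α) (r : GapTree α) :
    (linkLeft k l a r).entries = l.entries ++ (k, a) :: r.entries := by
  unfold linkLeft
  split
  · rfl
  · split_ifs <;> simp [entries]

@[simp] theorem entries_linkRight (k : ℕ) (l : GapTree α) (a : α) (r : GapTree α) :
    (linkRight k l a r).entries = l.entries ++ (k, a) :: r.entries := by
  unfold linkRight
  split
  · rfl
  · split_ifs <;> simp [entries]

theorem HeapOrdered.entries_le {t : GapTree α} (h : t.HeapOrdered) :
    ∀ p ∈ t.entries, p.1 ≤ t.level := by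
  induction t with
  | nil => simp [entries]
  | node k l a r ihl ihr =>
    obtain ⟨h1, h2, h3, h4⟩ := h
    intro p hp
    simp only [entries, List.mem_append, List.mem_cons] at hp
    rcases hp with hp | rfl | hp
    · exact (ihl h3 p hp).trans h1.le
    · exact le_rfl
    · exact (ihr h4 p hp).trans h2

/-- All runs that start away from the run of the root have at most `maxRun` nodes. -/
def SpineBounded : GapTree α → Prop
  | nil => True
  | node k l _ r =>
    l.RunsBounded maxRun ∧ if r.level = k then r.SpineBounded else r.RunsBounded maxRun

theorem runsBounded_iff {t : GapTree α} :
    t.RunsBounded maxRun ↔ t.SpineBounded ∧ t.runLength ≤ maxRun := by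
  induction t with
  | nil => simp [RunsBounded, SpineBounded, runLength]
  | node k l a r ihl ihr =>
    simp only [RunsBounded, SpineBounded, runLength]
    split_ifs with h
    · rw [ihr]
      constructor
      · tauto
      · rintro ⟨⟨h1, h2⟩, h3⟩
        exact ⟨h3, h1, h2, by omega⟩
    · tauto

/-- The outcome of lifting a node of the run of a tree of level `k`. -/
theorem promote_spec {t : GapTree α} (ht : t.HeapOrdered) (hs : t.SpineBounded) {i : ℕ}
    (hi : i < t.runLength) (hi1 : i ≤ maxRun) (hi2 : t.runLength ≤ maxRun + i + 1) :
    ∃ l c r, t.promote i = node (t.level + 1) l c r ∧ l.HeapOrdered ∧ r.HeapOrdered ∧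
      l.level ≤ t.level ∧ r.level ≤ t.level ∧ l.RunsBounded maxRun ∧ r.RunsBounded maxRun ∧
      (l.level = t.level → l.runLength ≤ i) := by
  induction t generalizing i with
  | nil => simp [runLength] at hi
  | node k l a r ihl ihr =>
    obtain ⟨h1, h2, h3, h4⟩ := ht
    obtain ⟨s1, s2⟩ := hs
    simp only [runLength] at hi hi2
    cases i with
    | zero =>
      refine ⟨l, a, r, rfl, h3, h4, h1.le, h2, s1, ?_, fun h => absurd h h1.ne⟩
      split_ifs at s2 hi2 with h
      · exact runsBounded_iff.2 ⟨s2, by omega⟩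
      · exact s2
    | succ i =>
      split_ifs at s2 hi hi2 with h
      · obtain ⟨l', c, r', e1, e2, e3, e4, e5, e6, e7, e8⟩ :=
          ihr h4 s2 (i := i) (by omega) (by omega) (by omega)
        rw [h] at e1 e4 e5 e8
        have hl : (node k l a l').runLength ≤ i + 1 := by
          simp only [runLength]
          split_ifs with h
          · have := e8 h; omega
          · omega
        refine ⟨node k l a l', c, r', ?_, ⟨h1, e4, h3, e2⟩, e3, le_rfl, e5,
          ⟨hl.trans hi1, s1, e6⟩, e7, fun _ => hl⟩
        simp only [promote, e1, linkRight, level]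
        rw [if_pos (Nat.lt_succ_self k)]
      · omega

/-- The counts on both sides of the lifted node are what `raise_middle` needs: the other nodes of
the run all have the level of the root. -/
theorem promote_entries {t : GapTree α} {i : ℕ} (hi : i < t.runLength) :
    ∃ X a Y, t.entries = X ++ (t.level, a) :: Y ∧
      (t.promote i).entries = X ++ (t.level + 1, a) :: Y ∧
      i ≤ X.countP (fun p => p.1 == t.level) ∧
      t.runLength ≤ Y.countP (fun p => p.1 == t.level) + i + 1 := by
  induction t generalizing i with
  | nil => simp [runLength] at hi
  | node k l a r ihl ihr =>
    simp only [runLength] at hi ⊢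
    cases i with
    | zero =>
      refine ⟨l.entries, a, r.entries, rfl, rfl, Nat.zero_le _, ?_⟩
      split_ifs with h
      · by_cases h0 : 0 < r.runLength
        · obtain ⟨X, b, Y, h1, -, h3, h4⟩ := ihr h0
          rw [h] at h1 h3 h4
          rw [h1, List.countP_append, List.countP_cons_of_pos (by simp [level])]
          simp only [level]
          omega
        · omega
      · omega
    | succ i =>
      split_ifs at hi ⊢ with h
      · obtain ⟨X, b, Y, h1, h2, h3, h4⟩ := ihr (i := i) (by omega)
        rw [h] at h1 h2 h3 h4
        refine ⟨l.entries ++ (k, a) :: X, b, Y, by simp [entries, h1, level],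
          by simp [promote, h2, level], ?_, by simp only [level]; omega⟩
        rw [List.countP_append, List.countP_cons_of_pos (by simp [level])]
        simp only [level]
        omega
      · omega

/-- The 21 steps occur for a run of 13: 14 to measure it and 7 to lift node number 6. -/
theorem fixRun_spec {t : GapTree α} (ht : t.HeapOrdered) (hs : t.SpineBounded)
    (hr : t.runLength ≤ maxRun + 1) :
    t.fixRun.1.HeapOrdered ∧ t.fixRun.1.RunsBounded maxRun ∧ t.fixRun.2 ≤ 21 ∧
      (t.fixRun.1 = t ∨ t.runLength = maxRun + 1 ∧ t.fixRun.1.level = t.level + 1 ∧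
        t.fixRun.1.runLength = 1) := by
  unfold fixRun
  split_ifs with h
  · simp only [maxRun] at h hr ⊢
    have hl : t.runLength = 13 := by omega
    obtain ⟨l, c, r, e1, e2, e3, e4, e5, e6, e7, e8⟩ :=
      promote_spec ht hs (i := t.runLength / 2) (by omega) (by simp only [maxRun]; omega)
        (by simp only [maxRun]; omega)
    have hrl : (node (t.level + 1) l c r).runLength = 1 := by
      simp only [runLength]
      rw [if_neg (by omega)]
    simp only [e1]
    exact ⟨⟨by omega, by omega, e2, e3⟩, ⟨by omega, e6, e7⟩, by omega,
      Or.inr ⟨hl, rfl, hrl⟩⟩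
  · exact ⟨ht, runsBounded_iff.2 ⟨hs, not_lt.1 h⟩, by simp only [maxRun] at h ⊢; omega,
      Or.inl rfl⟩

/-- Levels and weights, from left to right. -/
def weights (weight : α → ℕ) (L : List (ℕ × α)) : List (ℕ × ℕ) :=
  L.map fun p => (p.1, weight p.2)

theorem promote_windowsHeavy {weight : α → ℕ} {t : GapTree α} (ht : t.HeapOrdered) {i : ℕ}
    (hi : 6 ≤ i) (hi2 : i + 7 ≤ t.runLength) :
    ∃ X a Y, t.entries = X ++ (t.level, a) :: Y ∧
      (t.promote i).entries = X ++ (t.level + 1, a) :: Y ∧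
      ∀ A B, WindowsHeavy (A ++ weights weight t.entries ++ B) →
        WindowsHeavy (A ++ weights weight (t.promote i).entries ++ B) := by
  obtain ⟨X, a, Y, h1, h2, h3, h4⟩ := promote_entries (t := t) (i := i) (by omega)
  refine ⟨X, a, Y, h1, h2, fun A B h => ?_⟩
  have hle := ht.entries_le
  rw [h1] at h hle
  rw [h2]
  simp only [weights, List.map_append, List.map_cons] at h ⊢
  have hc : ∀ L : List (ℕ × α), (L.map fun p => (p.1, weight p.2)).countP
      (fun p => p.1 == t.level) = L.countP fun p => p.1 == t.level := by
    intro L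
    rw [List.countP_map]
    rfl
  refine h.raise_middle ?_ ?_ (by rw [hc]; omega) (by rw [hc]; omega)
  · intro p hp
    obtain ⟨q, hq, rfl⟩ := List.mem_map.1 hp
    exact hle q (by simp [hq])
  · intro p hp
    obtain ⟨q, hq, rfl⟩ := List.mem_map.1 hp
    exact hle q (by simp [hq])

/-- The invariants on the entries that an operation on a subtree has to maintain. -/
def Maintains (weight : α → ℕ) (L M : List (ℕ × α)) : Prop :=
  ((∀ p ∈ L, weight p.2 < 2 ^ p.1) → ∀ p ∈ M, weight p.2 < 2 ^ p.1) ∧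
  ∀ A B, WindowsHeavy (A ++ weights weight L ++ B) → WindowsHeavy (A ++ weights weight M ++ B)

theorem Maintains.trans {weight : α → ℕ} {L M N : List (ℕ × α)} (h : Maintains weight L M)
    (h' : Maintains weight M N) : Maintains weight L N :=
  ⟨fun H => h'.1 (h.1 H), fun A B H => h'.2 A B (h.2 A B H)⟩

theorem Maintains.context {weight : α → ℕ} {L M : List (ℕ × α)} (h : Maintains weight L M)
    (A B : List (ℕ × α)) : Maintains weight (A ++ L ++ B) (A ++ M ++ B) := by
  constructor
  · intro H p hp
    simp only [List.mem_append] at hp H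
    rcases hp with (hp | hp) | hp
    · exact H p (Or.inl (Or.inl hp))
    · exact h.1 (fun q hq => H q (Or.inl (Or.inr hq))) p hp
    · exact H p (Or.inr hp)
  · intro A' B' H
    have := h.2 (A' ++ weights weight A) (weights weight B ++ B')
    simp only [weights, List.map_append, List.append_assoc] at this H ⊢
    exact this H

theorem fixRun_maintains {weight : α → ℕ} {t : GapTree α} (ht : t.HeapOrdered) :
    Maintains weight t.entries t.fixRun.1.entries ∧ t.fixRun.1.items = t.items := by
  unfold fixRun
  split_ifs with h
  · simp only [maxRun] at h
    obtain ⟨X, a, Y, h1, h2, h3⟩ :=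
      promote_windowsHeavy (weight := weight) ht (i := t.runLength / 2) (by omega) (by omega)
    refine ⟨⟨fun H p hp => ?_, h3⟩, by simp [items, h1, h2]⟩
    rw [h2] at hp
    rw [h1] at H
    simp only [List.mem_append, List.mem_cons] at hp H
    rcases hp with hp | rfl | hp
    · exact H p (by simp [hp])
    · have := H (t.level, a) (by simp)
      simp only [pow_succ] at this ⊢
      omega
    · exact H p (by simp [hp])
  · exact ⟨⟨id, fun _ _ => id⟩, rfl⟩

@[simp] theorem level_node (k : ℕ) (l : GapTree α) (a : α) (r : GapTree α) :
    (node k l a r).level = k := rfl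

theorem runLength_pos {t : GapTree α} (h : 0 < t.level) : 0 < t.runLength := by
  cases t with
  | nil => simp [level] at h
  | node k l a r =>
    simp only [runLength]
    split_ifs <;> omega

/-- The shape of a subtree after the update of one of its gaps, before the run of its root is
fixed, relative to the tree `t` before the update. -/
def Updated (t u : GapTree α) : Prop :=
  u.HeapOrdered ∧ u.SpineBounded ∧
    ((u.level = t.level ∧ u.runLength ≤ t.runLength + 1) ∨
      ∃ l c r, u = node (t.level + 1) l c r ∧ l.level ≤ t.level ∧ r.level ≤ t.level ∧
        l.RunsBounded maxRun ∧ r.RunsBounded maxRun ∧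
        (l.level = t.level → l.runLength + 1 ≤ t.runLength))

theorem Updated.runLength_le {t u : GapTree α} (h : Updated t u)
    (ht : t.RunsBounded maxRun) : u.runLength ≤ maxRun + 1 := by
  have h1 := (runsBounded_iff.1 ht).2
  obtain ⟨-, -, ⟨-, h2⟩ | ⟨l, c, r, rfl, -, h3, -⟩⟩ := h
  · omega
  · simp only [runLength]
    rw [if_neg (by omega)]
    omega

theorem Updated.fixRun {t u : GapTree α} (h : Updated t u) (ht : t.RunsBounded maxRun) :
    u.fixRun.1.HeapOrdered ∧ u.fixRun.1.RunsBounded maxRun ∧ u.fixRun.2 ≤ 21 ∧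
      (u.fixRun.1.level = t.level ∨
        u.fixRun.1.level = t.level + 1 ∧ u.fixRun.1.runLength = 1) := by
  obtain ⟨h1, h2, h3, h4⟩ := fixRun_spec h.1 h.2.1 (h.runLength_le ht)
  refine ⟨h1, h2, h3, ?_⟩
  obtain ⟨-, -, ⟨h5, h6⟩ | ⟨l, c, r, rfl, -, h7, -⟩⟩ := h
  · rcases h4 with h4 | ⟨-, h4, h8⟩
    · rw [h4]
      exact Or.inl h5
    · exact Or.inr ⟨by omega, h8⟩
  · have h8 : (node (t.level + 1) l c r).runLength = 1 := by
      simp only [runLength]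
      rw [if_neg (by omega)]
    rcases h4 with h4 | ⟨h4, -⟩
    · rw [h4]
      exact Or.inr ⟨rfl, h8⟩
    · rw [h8] at h4
      simp [maxRun] at h4

theorem updated_linkLeft {k : ℕ} {l u r : GapTree α} {g : α}
    (ht : (node k l g r).HeapOrdered) (hr : (node k l g r).RunsBounded maxRun)
    (h : Updated l u) : Updated (node k l g r) (linkLeft k u.fixRun.1 g r) := by
  obtain ⟨h1, h2, h3, h4⟩ := ht
  obtain ⟨s1, s2, s3⟩ := hr
  obtain ⟨f1, f2, -, f3⟩ := h.fixRun s2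
  have hs := (runsBounded_iff.1 (show (node k l g r).RunsBounded maxRun from ⟨s1, s2, s3⟩)).1
  rcases hf : u.fixRun.1 with _ | ⟨j, l₁, c, l₂⟩
  · refine ⟨⟨by simp only [level]; omega, h2, trivial, h4⟩, ⟨trivial, hs.2⟩, Or.inl ⟨rfl, ?_⟩⟩
    simp only [linkLeft, runLength]
    split_ifs <;> omega
  · rw [hf] at f1 f2 f3
    simp only [level_node] at f3
    simp only [linkLeft]
    split_ifs with hj
    · obtain ⟨rfl, hl⟩ : j = k ∧ (node j l₁ c l₂).runLength = 1 := by
        rcases f3 with f3 | f3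
        · omega
        · exact ⟨by omega, f3.2⟩
      obtain ⟨f4, f5, f6, f7⟩ := f1
      obtain ⟨f8, f9, f10⟩ := f2
      -- A left child that has reached its parent's level was just lifted and is alone in its run.
      -- So its right subtree is strictly lower and may become a left subtree in the rotation.
      have hl2 : l₂.level < j := by
        refine lt_of_le_of_ne f5 fun h0 => ?_
        have := runLength_pos (t := l₂) (by omega)
        simp only [runLength, h0, if_true] at hl
        omega
      refine ⟨⟨f4, le_rfl, f6, hl2, h2, f7, h4⟩, ⟨f9, ?_⟩, Or.inl ⟨rfl, ?_⟩⟩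
      · rw [level_node, if_pos rfl]
        exact ⟨f10, hs.2⟩
      · simp only [runLength, level_node, if_true]
        omega
    · refine ⟨⟨by simpa using hj, h2, f1, h4⟩, ⟨f2, hs.2⟩, Or.inl ⟨rfl, ?_⟩⟩
      simp only [runLength]
      split_ifs <;> omega

theorem updated_fixRun_linkRight {k : ℕ} {l u r : GapTree α} {g : α}
    (ht : (node k l g r).HeapOrdered) (hr : (node k l g r).RunsBounded maxRun)
    (h : Updated r u) (hu : u.level < k) :
    Updated (node k l g r) (linkRight k l g u.fixRun.1) := by
  obtain ⟨h1, h2, h3, h4⟩ := ht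
  obtain ⟨s1, s2, s3⟩ := hr
  obtain ⟨f1, f2, -, f3⟩ := h.fixRun s3
  have hlev : u.fixRun.1.level ≤ k ∧ (u.fixRun.1.level = k → u.fixRun.1.runLength = 1) := by
    have hru : r.level ≤ u.level := by
      obtain ⟨-, -, ⟨h5, -⟩ | ⟨_, _, _, rfl, -⟩⟩ := h
      · omega
      · simp
    rcases f3 with f3 | f3
    · exact ⟨by omega, fun _ => by omega⟩
    · exact ⟨by omega, fun _ => f3.2⟩
  have hlink : linkRight k l g u.fixRun.1 = node k l g u.fixRun.1 := by
    rcases hf : u.fixRun.1 with _ | ⟨j, l₁, c, l₂⟩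
    · rfl
    · rw [hf] at hlev
      simp only [linkRight]
      rw [if_neg (by simpa using hlev.1)]
  rw [hlink]
  refine ⟨⟨h1, hlev.1, h3, f1⟩, ⟨s2, ?_⟩, Or.inl ⟨rfl, ?_⟩⟩
  · split_ifs
    · exact (runsBounded_iff.1 f2).1
    · exact f2
  · simp only [runLength]
    split_ifs with h5 h6 h6 <;> omega

theorem updated_linkRight {k : ℕ} {l u r : GapTree α} {g : α}
    (ht : (node k l g r).HeapOrdered) (hr : (node k l g r).RunsBounded maxRun)
    (h : Updated r u) (hu : k ≤ u.level) :
    Updated (node k l g r) (linkRight k l g u) := by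
  obtain ⟨h1, h2, h3, h4⟩ := ht
  obtain ⟨s1, s2, s3⟩ := hr
  obtain ⟨u1, u2, ⟨u3, u4⟩ | ⟨l', c, r', rfl, u3, u4, u5, u6, u7⟩⟩ := h
  · have hk : u.level = k := by omega
    have hlink : linkRight k l g u = node k l g u := by
      rcases u with _ | ⟨j, l₁, c, l₂⟩
      · rfl
      · simp only [linkRight]
        rw [if_neg (by simp at hk; omega)]
    rw [hlink]
    refine ⟨⟨h1, by omega, h3, u1⟩, ⟨s2, by rwa [if_pos hk]⟩, Or.inl ⟨rfl, ?_⟩⟩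
    simp only [runLength]
    rw [if_pos hk, if_pos (by omega)]
    omega
  · simp only [level_node] at hu
    simp only [linkRight]
    split_ifs with hk
    · obtain rfl : k = r.level := by omega
      obtain ⟨v1, v2, v3, v4⟩ := u1
      -- The lower part of the split run replaces the part of the old run below `g`. It is strictly
      -- shorter than the old run of `r`, so no bound is violated.
      have hb : (node r.level l g l').runLength ≤ (node r.level l g r).runLength := by
        simp only [runLength, if_true]
        split_ifs with h5
        · have := u7 h5
          omega
        · omega
      refine ⟨⟨by simp, v2, ⟨h1, u3, h3, v3⟩, v4⟩, ⟨⟨hb.trans s1, s2, u5⟩, ?_⟩,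
        Or.inr ⟨_, _, _, rfl, le_rfl, u4, ⟨hb.trans s1, s2, u5⟩, u6, fun _ => ?_⟩⟩
      · rw [if_neg (by omega)]
        exact u6
      · have := runLength_pos (t := r) (by omega)
        simp only [runLength, if_true]
        split_ifs with h5
        · have := u7 h5
          omega
        · omega
    · obtain rfl : k = r.level + 1 := by omega
      refine ⟨⟨h1, le_rfl, h3, u1⟩, ⟨s2, by rw [level_node, if_pos rfl]; exact u2⟩, Or.inl ⟨rfl, ?_⟩⟩
      simp only [runLength, level_node, if_true]
      rw [if_neg (by omega), if_neg (by omega)]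

theorem fixRun_items (t : GapTree α) : t.fixRun.1.items = t.items := by
  unfold fixRun
  split_ifs with h
  · simp only [maxRun] at h
    obtain ⟨X, a, Y, h1, h2, -⟩ := promote_entries (t := t) (i := t.runLength / 2) (by omega)
    simp [items, h1, h2]
  · rfl

theorem items_node (k : ℕ) (l : GapTree α) (a : α) (r : GapTree α) :
    (node k l a r).items = l.items ++ a :: r.items := by
  simp [items, entries]

theorem items_linkLeft (k : ℕ) (l : GapTree α) (a : α) (r : GapTree α) :
    (linkLeft k l a r).items = l.items ++ a :: r.items := by
  simp [items]

theorem items_linkRight (k : ℕ) (l : GapTree α) (a : α) (r : GapTree α) :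
    (linkRight k l a r).items = l.items ++ a :: r.items := by
  simp [items]

end General

/-! ### Locating and updating a gap in the biased tree -/

section Gaps

variable {K : Type u} {V : Type v}

/-- A weight that has reached `2 ^ k` fills both halves of the requirement of `raise` alone, so `X₂`
and `Y₁` are empty. Growth by one keeps the weight below `2 ^ (k + 1)`. -/
theorem maintains_grow {A B : List (ℕ × Gap K V)} {k : ℕ} {g g' : Gap K V}
    (hg : g'.size = g.size + 1) :
    Maintains Gap.size (A ++ (k, g) :: B)
      (A ++ (if 2 ^ k ≤ g'.size then k + 1 else k, g') :: B) := by
  constructor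
  · intro H p hp
    have hk := H (k, g) (by simp)
    simp only [List.mem_append, List.mem_cons] at hp
    rcases hp with hp | rfl | hp
    · exact H p (by simp [hp])
    · dsimp only at hk ⊢
      split_ifs <;> (try rw [pow_succ]) <;> omega
    · exact H p (by simp [hp])
  · intro A' B' H
    simp only [weights, List.map_append, List.map_cons, List.append_assoc, List.cons_append] at H ⊢
    rw [← List.append_assoc] at H ⊢
    split_ifs with h
    · exact H.raise (X₁ := A' ++ A.map fun p => (p.1, p.2.size)) (X₂ := []) (Y₁ := []) (by omega)
        (by simp) (by simp) (by simpa using h) rfl (by simp) (by simpa using h)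
    · exact H.mono (by omega)

variable [LinearOrder K]

/-- One strict inequality is carried along because it excludes the empty tree, where `a = b`. -/
theorem locate_isSome {a b : Ext K} {t : GapTree (Gap K V)} {x : K}
    (hT : Tiles a (t.items.map fun g => (g.lo, g.hi)) b) (ha : a ≤ ext x) (hb : ext x ≤ b)
    (hab : a < ext x ∨ ext x < b) : ∃ g, (t.locate x).1 = some g := by
  induction t generalizing a b with
  | nil =>
    obtain rfl : a = b := hT
    rcases hab with h | h
    · exact absurd hb h.not_ge
    · exact absurd ha h.not_ge
  | node k l g r ihl ihr =>
    simp only [items, entries, List.map_append, List.map_cons] at hT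
    obtain ⟨c, h1, h2, h3, h4⟩ := tiles_append.1 hT
    dsimp only at h2 h3 h4
    subst h2
    simp only [locate]
    split_ifs with hl hr
    · exact ihl h1 ha hl.le (Or.inr hl)
    · exact ⟨g, rfl⟩
    · exact ihr h4 (not_le.1 hr).le hb (Or.inl (not_le.1 hr))

theorem update_items {t : GapTree (Gap K V)} {x : K} {g : Gap K V} (g' : Gap K V)
    (h : (t.locate x).1 = some g) : ∃ A B, t.items = A ++ g :: B ∧
      g.lo ≤ ext x ∧ ext x ≤ g.hi ∧ (t.update x g').1.items = A ++ g' :: B := by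
  induction t with
  | nil => simp [locate] at h
  | node k l c r ihl ihr =>
    simp only [locate, update] at h ⊢
    split_ifs at h ⊢ with h1 h2 h3 h4
    all_goals try simp only [items_node, items_linkLeft, items_linkRight, fixRun_items]
    · obtain ⟨A, B, e1, e2, e3, e4⟩ := ihl h
      exact ⟨A, B ++ c :: r.items, by simp [e1], e2, e3, by simp [e4]⟩
    · obtain rfl : c = g := by simpa using h
      exact ⟨l.items, r.items, rfl, not_lt.1 h1, h2, rfl⟩
    · obtain rfl : c = g := by simpa using h
      exact ⟨l.items, r.items, rfl, not_lt.1 h1, h2, rfl⟩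
    · obtain ⟨A, B, e1, e2, e3, e4⟩ := ihr h
      exact ⟨l.items ++ c :: A, B, by simp [e1], e2, e3, by simp [e4]⟩
    · obtain ⟨A, B, e1, e2, e3, e4⟩ := ihr h
      exact ⟨l.items ++ c :: A, B, by simp [e1], e2, e3, by simp [e4]⟩

theorem update_updated {t : GapTree (Gap K V)} (ht : t.HeapOrdered) (hr : t.RunsBounded maxRun)
    (x : K) (g' : Gap K V) : Updated t (t.update x g').1 := by
  induction t with
  | nil => exact ⟨trivial, trivial, Or.inl ⟨rfl, by simp [update]⟩⟩
  | node k l g r ihl ihr =>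
    have hl := ihl ht.2.2.1 hr.2.1
    have hrr := ihr ht.2.2.2 hr.2.2
    simp only [update]
    split_ifs with h1 h2 h3 h4
    · exact updated_linkLeft ht hr hl
    · obtain ⟨a1, a2, a3, a4⟩ := ht
      refine ⟨⟨by omega, by omega, a3, a4⟩, ⟨hr.2.1, ?_⟩, Or.inr
        ⟨l, g', r, rfl, a1.le, a2, hr.2.1, hr.2.2, fun h => absurd h a1.ne⟩⟩
      rw [if_neg (by omega)]
      exact hr.2.2
    · exact ⟨ht, (runsBounded_iff.1 hr).1, Or.inl ⟨rfl, Nat.le_succ _⟩⟩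
    · exact updated_fixRun_linkRight ht hr hrr h4
    · exact updated_linkRight ht hr hrr (not_lt.1 h4)

theorem update_maintains {t : GapTree (Gap K V)} (ht : t.HeapOrdered)
    (hr : t.RunsBounded maxRun) {x : K} {g g' : Gap K V} (h : (t.locate x).1 = some g)
    (hg : g'.size = g.size + 1) :
    Maintains Gap.size t.entries (t.update x g').1.entries := by
  induction t with
  | nil => simp [locate] at h
  | node k l c r ihl ihr =>
    have hl := update_updated ht.2.2.1 hr.2.1 x g'
    have hrr := update_updated ht.2.2.2 hr.2.2 x g'
    simp only [locate, update] at h ⊢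
    split_ifs at h ⊢ with h1 h2 h3 h4
    · have := ((ihl ht.2.2.1 hr.2.1 h).trans (fixRun_maintains hl.1).1).context [] ((k, c) :: r.entries)
      simpa [entries] using this
    · obtain rfl : c = g := by simpa using h
      have := maintains_grow (A := l.entries) (B := r.entries) (k := k) hg
      rwa [if_pos h3] at this
    · obtain rfl : c = g := by simpa using h
      have := maintains_grow (A := l.entries) (B := r.entries) (k := k) hg
      rwa [if_neg h3] at this
    · have := ((ihr ht.2.2.2 hr.2.2 h).trans (fixRun_maintains hrr.1).1).context
        (l.entries ++ [(k, c)]) []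
      simpa [entries] using this
    · have := (ihr ht.2.2.2 hr.2.2 h).context (l.entries ++ [(k, c)]) []
      simpa [entries] using this

/-- The time on the way to the gap and back is bounded by the difference of levels. -/
theorem locate_update_cost {t : GapTree (Gap K V)} (ht : t.HeapOrdered)
    (hr : t.RunsBounded maxRun) {x : K} {g : Gap K V} (g' : Gap K V)
    (h : (t.locate x).1 = some g) :
    ∃ k, (k, g) ∈ t.entries ∧ (t.locate x).2 ≤ 3 * (12 * (t.level - k) + t.runLength) ∧
      (t.update x g').2 ≤ 26 * (12 * (t.level - k) + t.runLength) := by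
  induction t with
  | nil => simp [locate] at h
  | node k l c r ihl ihr =>
    have hl := (update_updated ht.2.2.1 hr.2.1 x g').fixRun hr.2.1 |>.2.2.1
    have hrr := (update_updated ht.2.2.2 hr.2.2 x g').fixRun hr.2.2 |>.2.2.1
    have hlr := (runsBounded_iff.1 hr.2.1).2
    have hrrr := (runsBounded_iff.1 hr.2.2).2
    have hpos : 0 < (node k l c r).runLength := runLength_pos (by simp; have := ht.1; omega)
    have hlev := ht.1
    have hlev' := ht.2.1
    simp only [maxRun] at hlr hrrr
    -- The potential `12 * (level - j) + runLength` drops with each move: inside a run the length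
    -- falls by one, and a drop of level releases 12, enough for any new run. Each node costs at
    -- most 3 in `locate` and `21 + 5 = 26` in `update`.
    have hstep : ∀ j, (j, g) ∈ r.entries →
        12 * (r.level - j) + r.runLength + 1 ≤ 12 * (k - j) + (node k l c r).runLength := by
      intro j hj
      have := ht.2.2.2.entries_le _ hj
      dsimp only at this
      simp only [runLength]
      split_ifs with hk <;> omega
    simp only [locate, update] at h ⊢
    split_ifs at h ⊢ with h1 h2 h3 h4
    · obtain ⟨j, e1, e2, e3⟩ := ihl ht.2.2.1 hr.2.1 h
      have := ht.2.2.1.entries_le _ e1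
      exact ⟨j, by simp [entries, e1], by simp only [level_node] at *; omega,
        by simp only [level_node] at *; omega⟩
    · obtain rfl : c = g := by simpa using h
      exact ⟨k, by simp [entries], by simp only [level_node]; omega, by simp only [level_node]; omega⟩
    · obtain rfl : c = g := by simpa using h
      exact ⟨k, by simp [entries], by simp only [level_node]; omega, by simp only [level_node]; omega⟩
    · obtain ⟨j, e1, e2, e3⟩ := ihr ht.2.2.2 hr.2.2 h
      have := hstep j e1
      exact ⟨j, by simp [entries, e1], by simp only [level_node]; omega,
        by simp only [level_node]; omega⟩
    · obtain ⟨j, e1, e2, e3⟩ := ihr ht.2.2.2 hr.2.2 h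
      have := hstep j e1
      exact ⟨j, by simp [entries, e1], by simp only [level_node]; omega,
        by simp only [level_node]; omega⟩

/-- Insertion into a lazy search tree. -/
theorem insert_spec {t : GapTree (Gap K V)} (ht : IsLazySearchTree t) (e : K × V) :
    IsLazySearchTree (t.insert e).1 ∧ ∃ A g B, t.items = A ++ g :: B ∧
      (t.locate e.1).1 = some g ∧ g.lo ≤ ext e.1 ∧ ext e.1 ≤ g.hi ∧
      (t.insert e).1.items = A ++ (g.insert e).1 :: B ∧
      (g.insert e).1.elements.Perm (e :: g.elements) := by
  obtain ⟨⟨hT, hwf⟩, hh, hr, hw, hwin⟩ := ht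
  obtain ⟨g, hg⟩ := locate_isSome hT bot_le le_top (Or.inl (bot_lt_ext e.1))
  obtain ⟨A, B, h1, h2, h3, h4⟩ := update_items (g.insert e).1 hg
  have hgw := hwf g (by simp [h1])
  obtain ⟨-, -, -, -, -, -, -, i1, i2, i3⟩ := g.insert_spec hgw.2.2.2.1 e
  have hins : (t.insert e).1 = (t.update e.1 (g.insert e).1).1.fixRun.1 := by
    simp [insert, hg]
  have hu := update_updated hh hr e.1 (g.insert e).1
  have hf := hu.fixRun hr
  have hm := (update_maintains hh hr hg i1).trans (fixRun_maintains hu.1).1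
  have hit : (t.insert e).1.items = A ++ (g.insert e).1 :: B := by
    rw [hins, fixRun_items, h4]
  refine ⟨⟨⟨?_, ?_⟩, ?_⟩, A, g, B, h1, hg, h2, h3, hit, g.insert_elements_perm hgw.2.2.2.1 e⟩
  · rw [hit]
    rw [h1] at hT
    simpa [i2, i3] using hT
  · rw [hit]
    rw [h1] at hwf
    intro c hc
    simp only [List.mem_append, List.mem_cons] at hc hwf
    rcases hc with hc | rfl | hc
    · exact hwf c (by simp [hc])
    · exact hgw.insert e h2 h3
    · exact hwf c (by simp [hc])
  · rw [hins]
    refine ⟨hf.1, hf.2.1, hm.1 hw, ?_⟩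
    have := hm.2 [] []
    simp only [List.nil_append, List.append_nil] at this
    exact this hwin

end Gaps

/-! ### Existence of biased trees -/

section Existence

variable {α : Type u}

/-- Put an item with a level in front of all items of a tree. -/
def cons (k : ℕ) (a : α) : GapTree α → GapTree α
  | nil => node k nil a nil
  | node j l c r => if j ≤ k then node k nil a (node j l c r) else node j (l.cons k a) c r

theorem entries_cons (k : ℕ) (a : α) (t : GapTree α) :
    (t.cons k a).entries = (k, a) :: t.entries := by
  induction t with
  | nil => rfl
  | node j l c r ihl _ =>
    simp only [cons]
    split_ifs
    · rfl
    · simp [entries, ihl]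

theorem HeapOrdered.cons {k : ℕ} (hk : 0 < k) (a : α) {t : GapTree α} (ht : t.HeapOrdered) :
    (t.cons k a).HeapOrdered ∧ (t.cons k a).level = max k t.level := by
  induction t with
  | nil => exact ⟨⟨hk, Nat.zero_le _, trivial, trivial⟩, (Nat.max_zero k).symm⟩
  | node j l c r ihl _ =>
    simp only [GapTree.cons]
    split_ifs with h
    · exact ⟨⟨hk, h, trivial, ht⟩, by simp [h]⟩
    · obtain ⟨h1, h2, h3, h4⟩ := ht
      obtain ⟨i1, i2⟩ := ihl h3
      exact ⟨⟨by omega, h2, i1, h4⟩, by simp only [level_node]; omega⟩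

/-- Items are put in front from right to left. On a tie of levels the old tree becomes the right
child, where equal levels are allowed. -/
theorem exists_heapOrdered (L : List (ℕ × α)) (hL : ∀ p ∈ L, 0 < p.1) :
    ∃ t : GapTree α, t.HeapOrdered ∧ t.entries = L := by
  induction L with
  | nil => exact ⟨nil, trivial, rfl⟩
  | cons p L ih =>
    obtain ⟨t, h1, h2⟩ := ih fun q hq => hL q (by simp [hq])
    exact ⟨t.cons p.1 p.2, (h1.cons (hL p (by simp)) p.2).1, by rw [entries_cons, h2]⟩

theorem exists_long_run {t : GapTree α} (ht : t.HeapOrdered) (hr : ¬ t.RunsBounded maxRun) :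
    ∃ A s B, t.entries = A ++ entries s ++ B ∧ s.HeapOrdered ∧ maxRun < s.runLength := by
  induction t with
  | nil => exact absurd trivial hr
  | node k l a r ihl ihr =>
    by_cases h : (node k l a r).runLength ≤ maxRun
    · by_cases hl : l.RunsBounded maxRun
      · obtain ⟨A, s, B, h1, h2⟩ := ihr ht.2.2.2 fun h0 => hr ⟨h, hl, h0⟩
        exact ⟨l.entries ++ (k, a) :: A, s, B, by simp [entries, h1], h2⟩
      · obtain ⟨A, s, B, h1, h2⟩ := ihl ht.2.2.1 hl
        exact ⟨A, s, B ++ (k, a) :: r.entries, by simp [entries, h1], h2⟩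
    · exact ⟨[], node k l a r, [], by simp, ht, not_le.1 h⟩

theorem WindowsHeavy.two_pow_le {L : List (ℕ × ℕ)} (h : WindowsHeavy L) {p : ℕ × ℕ}
    (hp : p ∈ L) : 2 ^ p.1 ≤ 2 * weightSum L := by
  obtain ⟨A, B, rfl⟩ := List.append_of_mem hp
  have h1 := h A p.1 p.2 B rfl
  have h2 := reach_le p.1 A.reverse
  have h3 := reach_le p.1 B
  simp only [weightSum_reverse, weightSum_append, weightSum_cons] at *
  omega

theorem weightSum_weights (weight : α → ℕ) (L : List (ℕ × α)) :
    weightSum (weights weight L) = ((L.map Prod.snd).map weight).sum := by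
  simp [weightSum, weights, Function.comp_def]

/-- A crude bound, from `k < 2 ^ k ≤ 2 * total`; it serves only to make the repeated lifting of
levels terminate. -/
theorem sum_levels_le (weight : α → ℕ) {L : List (ℕ × α)}
    (h : WindowsHeavy (weights weight L)) : (L.map Prod.fst).sum ≤
      (L.map Prod.snd).length * (2 * ((L.map Prod.snd).map weight).sum) := by
  have := List.sum_le_card_nsmul (L.map Prod.fst) (2 * ((L.map Prod.snd).map weight).sum) ?_
  · simpa using this
  · intro k hk
    obtain ⟨p, hp, rfl⟩ := List.mem_map.1 hk
    have h1 := h.two_pow_le (p := (p.1, weight p.2)) (List.mem_map.2 ⟨p, hp, rfl⟩)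
    rw [weightSum_weights] at h1
    exact Nat.lt_two_pow_self.le.trans h1

/-- Levels can be raised until no run is too long. -/
theorem exists_biased_of_levels (weight : α → ℕ) (L : List (ℕ × α)) (hpos : ∀ p ∈ L, 0 < p.1)
    (hw : ∀ p ∈ L, weight p.2 < 2 ^ p.1) (h : WindowsHeavy (weights weight L)) :
    ∃ t : GapTree α, t.Biased weight ∧ t.items = L.map Prod.snd := by
  -- The measure is the slack in `sum_levels_le`; one lift raises the sum of levels by one and
  -- leaves the items unchanged.
  induction hn : (L.map Prod.snd).length * (2 * ((L.map Prod.snd).map weight).sum) -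
    (L.map Prod.fst).sum using Nat.strong_induction_on generalizing L with
  | _ n ih =>
    obtain ⟨t, ht, rfl⟩ := exists_heapOrdered L hpos
    by_cases hr : t.RunsBounded maxRun
    · exact ⟨t, ⟨ht, hr, hw, h⟩, rfl⟩
    · obtain ⟨A, s, B, h1, hs, h2⟩ := exists_long_run ht hr
      simp only [maxRun] at h2
      obtain ⟨X, a, Y, h3, h4, h5⟩ :=
        promote_windowsHeavy (weight := weight) hs (i := s.runLength / 2) (by omega) (by omega)
      have h6 : WindowsHeavy
          (weights weight (A ++ (s.promote (s.runLength / 2)).entries ++ B)) := by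
        have := h5 (weights weight A) (weights weight B)
        simp only [weights, ← List.map_append, ← h1] at this
        exact this h
      have h7 : (A ++ (s.promote (s.runLength / 2)).entries ++ B).map Prod.snd =
          t.entries.map Prod.snd := by
        simp [h1, h3, h4]
      have h8 : ((A ++ (s.promote (s.runLength / 2)).entries ++ B).map Prod.fst).sum =
          (t.entries.map Prod.fst).sum + 1 := by
        simp [h1, h3, h4]
        omega
      have h9 := sum_levels_le weight h6
      have mem : ∀ q ∈ A ++ (s.promote (s.runLength / 2)).entries ++ B,
          ∃ p ∈ t.entries, p.1 ≤ q.1 ∧ p.2 = q.2 := by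
        intro q hq
        rw [h1, h3]
        rw [h4] at hq
        simp only [List.mem_append, List.mem_cons] at hq
        rcases hq with (hq | hq | rfl | hq) | hq
        · exact ⟨q, by simp [hq], le_rfl, rfl⟩
        · exact ⟨q, by simp [hq], le_rfl, rfl⟩
        · exact ⟨(s.level, a), by simp, Nat.le_succ _, rfl⟩
        · exact ⟨q, by simp [hq], le_rfl, rfl⟩
        · exact ⟨q, by simp [hq], le_rfl, rfl⟩
      rw [← h7]
      refine ih _ ?_ _ ?_ ?_ h6 rfl
      · rw [h7] at h9 ⊢
        omega
      · intro q hq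
        obtain ⟨p, hp, hpq, -⟩ := mem q hq
        exact (hpos p hp).trans_le hpq
      · intro q hq
        obtain ⟨p, hp, hpq, hpe⟩ := mem q hq
        exact hpe ▸ (hw p hp).trans_le (Nat.pow_le_pow_right two_pos hpq)

theorem exists_biased (weight : α → ℕ) (L : List α) (hL : ∀ a ∈ L, 0 < weight a) :
    ∃ t : GapTree α, t.Biased weight ∧ t.items = L := by
  -- With level `log₂ w + 1`, each item alone is heavy enough for its own window.
  have := exists_biased_of_levels weight (L.map fun a => (Nat.log 2 (weight a) + 1, a)) ?_ ?_ ?_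
  · simpa [Function.comp_def] using this
  · simp
  · intro p hp
    obtain ⟨a, -, rfl⟩ := List.mem_map.1 hp
    exact Nat.lt_pow_succ_log_self one_lt_two _
  · intro A k w B h
    have hm : (k, w) ∈ weights weight (L.map fun a => (Nat.log 2 (weight a) + 1, a)) := by
      rw [h]
      simp
    simp only [weights, List.map_map, List.mem_map, Function.comp_apply, Prod.mk.injEq] at hm
    obtain ⟨a, ha, rfl, rfl⟩ := hm
    have := Nat.pow_log_le_self 2 (hL a ha).ne'
    rw [pow_succ]
    omega

end Existence

end GapTree

/-! ### Rule (B) and the average index of the interval -/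

namespace Gap

variable {K : Type u} {V : Type v}

/-- Terms of equal parity grow geometrically, so each of the two subsequences sums to at most twice
its last term. -/
theorem sum_le_of_doubling (c : ℕ → ℕ) (m : ℕ) (h : ∀ j, j + 2 ≤ m → 2 * c j ≤ c (j + 2))
    (hm : Monotone c) : ∑ j ∈ Finset.range (m + 1), c j ≤ 2 * (c m + c (m - 1)) := by
  induction m with
  | zero => simp; omega
  | succ m ih =>
    have h1 := ih fun j hj => h j (by omega)
    rw [Finset.sum_range_succ]
    cases m with
    | zero => simp at h1 ⊢; have := hm (Nat.zero_le 1); omega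
    | succ m =>
      have h2 : 2 * c m ≤ c (m + 1 + 1) := h m (by omega)
      simp only [Nat.add_sub_cancel] at *
      omega

theorem count_take_mono (L : List (Interval K V)) : Monotone fun j => count (L.take j) := by
  refine monotone_nat_of_le_succ fun j => ?_
  rw [List.take_add_one, count_append]
  omega

/-- Prefixes that double in size with every second interval are small on average. -/
theorem sum_count_take_le {L : List (Interval K V)}
    (hL : ∀ A I J B, L = A ++ I :: J :: B → count A < I.bag.length + J.bag.length) :
    ∑ j ∈ Finset.range L.length, (count (L.take j) + 1) ≤ 4 * (count L + 1) := by
  have hm : Monotone fun j => count (L.take j) + 1 :=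
    fun i j h => Nat.add_le_add_right (count_take_mono L h) 1
  -- The added 1 makes Rule (B) an exact doubling: `2 * a + 1` elements after two more intervals
  -- give `2 * (a + 1)`. It also counts the ranks `0, …, a` that a prefix of `a` elements covers.
  have h1 := sum_le_of_doubling (fun j => count (L.take j) + 1) L.length ?_ hm
  · rw [Finset.sum_range_succ] at h1
    have h2 : count (L.take (L.length - 1)) + 1 ≤ count (L.take L.length) + 1 :=
      hm (Nat.sub_le _ _)
    simp only [List.take_length] at h1 h2
    omega
  · intro j hj
    have e1 : L.drop j = L[j] :: L[j + 1] :: L.drop (j + 2) := by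
      rw [List.drop_eq_getElem_cons (by omega), List.drop_eq_getElem_cons (by omega)]
    have h2 := hL (L.take j) L[j] L[j + 1] (L.drop (j + 2)) (by rw [← e1, List.take_append_drop])
    have e2 : L.take (j + 2) = L.take j ++ [L[j], L[j + 1]] := by
      rw [List.take_succ_eq_append_getElem (i := j + 1) (by omega),
        List.take_succ_eq_append_getElem (i := j) (by omega), List.append_assoc]
      rfl
    simp only [e2, count_append, count_cons]
    have : count ([] : List (Interval K V)) = 0 := rfl
    omega

/-- The number of prefixes that contain at least `r` elements. -/
def outward (L : List (Interval K V)) (r : ℕ) : ℕ :=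
  ((Finset.range L.length).filter fun j => r ≤ count (L.take j)).card

/-- Every proper prefix of `L` that includes `I` contains at least `r` elements, and there are
`B.length` of these. -/
theorem length_le_outward {L A B : List (Interval K V)} {I : Interval K V} {r : ℕ}
    (h : L = A ++ I :: B) (hr : B ≠ [] → r ≤ count (A ++ [I])) : B.length ≤ outward L r := by
  by_cases hB : B = []
  · simp [hB]
  · have hlen : L.length = A.length + 1 + B.length := by rw [h]; simp; omega
    have : (Finset.Ico (A.length + 1) L.length).card = B.length := by simp [hlen]
    rw [← this]
    refine Finset.card_le_card fun j hj => ?_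
    rw [Finset.mem_Ico] at hj
    rw [Finset.mem_filter, Finset.mem_range]
    refine ⟨hj.2, (hr hB).trans ?_⟩
    have h2 := count_take_mono L hj.1
    have h3 : L.take (A.length + 1) = A ++ [I] := by
      rw [h, List.take_append]
      simp
    simpa [h3] using h2

/-- Double counting: a prefix of `a` elements is counted for the ranks `r ≤ a` only, at most `a + 1`
times. -/
theorem sum_outward_le (L : List (Interval K V)) (n : ℕ) :
    ∑ r ∈ Finset.range n, outward L r ≤ ∑ j ∈ Finset.range L.length, (count (L.take j) + 1) := by
  simp only [outward, Finset.card_filter]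
  rw [Finset.sum_comm]
  refine Finset.sum_le_sum fun j _ => ?_
  rw [← Finset.card_filter, ← Finset.card_range (count (L.take j) + 1)]
  refine Finset.card_le_card fun r hr => ?_
  rw [Finset.mem_filter] at hr
  rw [Finset.mem_range]
  omega

/-- A bound for the index of the interval that receives an element of rank `r`. -/
def rankCost (g : Gap K V) (r : ℕ) : ℕ :=
  outward g.left r + outward g.right.reverse (g.size - r)

/-- The two sides contribute `4 * (a + 1)` and `4 * (b + 1)` with `a + b = size`. On the right side
ranks are counted from the right end, hence the reflection of the sum. -/
theorem sum_rankCost_le {g : Gap K V} (hs : g.size = g.elements.length) (hB : g.RuleB) :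
    ∑ r ∈ Finset.range (g.size + 1), g.rankCost r ≤ 8 * (g.size + 1) := by
  have hcount : g.size = count g.left + count g.right := by
    rw [hs, ← count_append]
    rfl
  simp only [rankCost, Finset.sum_add_distrib]
  have h1 := (sum_outward_le g.left (g.size + 1)).trans (sum_count_take_le hB.1)
  have h2 := (sum_outward_le g.right.reverse (g.size + 1)).trans (sum_count_take_le ?_)
  · have h3 := Finset.sum_range_reflect (fun r => outward g.right.reverse r) (g.size + 1)
    simp only [Nat.add_sub_cancel] at h3
    rw [h3]
    rw [count_reverse] at h2
    omega
  · intro A I J B h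
    have := hB.2 B.reverse J I A.reverse (by rw [← List.reverse_reverse g.right, h]; simp)
    rwa [count_reverse] at this

variable [LinearOrder K]

/-- When the index is positive, elements nearer the middle than the chosen interval lie strictly
beyond the key. So the rank, counted from the outer end, is at most the number of elements up to and
including that interval. -/
theorem insert_cost {g : Gap K V} (hg : g.WellFormed) (e : K × V) {r : ℕ}
    (hr : g.IsRank e.1 r) : (g.insert e).2 ≤ 2 * g.rankCost r + 4 := by
  obtain ⟨-, h2, -, h4, h5⟩ := hg
  obtain ⟨hr1, hr2⟩ := hr
  have hins : (g.insert e).2 = (g.find e.1).2 + 1 := rfl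
  obtain ⟨I, A, B, -, -, hc, ⟨-, hl, hi, hfar⟩ | ⟨-, hl, hi, hfar⟩⟩ := g.find_spec h4 e.1
  · have : B.length ≤ outward g.left r := by
      refine length_le_outward hl fun hB => hr2.trans ?_
      have e1 : g.elements = (A ++ [I]).flatMap Interval.bag ++
          (B ++ g.right).flatMap Interval.bag := by
        simp [elements, intervals, hl]
      rw [e1, List.countP_append]
      have e2 : ((B ++ g.right).flatMap Interval.bag).countP (fun y => y.1 ≤ e.1) = 0 := by
        rw [List.countP_eq_zero]
        intro y hy
        obtain ⟨J, hJ, hyJ⟩ := List.mem_flatMap.1 hy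
        have k1 := hfar hB J hJ
        have k2 := (h5 J (by simp only [intervals, hl]; simp at hJ ⊢; tauto) y hyJ).1
        have := ext_lt_ext.1 (k1.trans_le k2)
        simpa using this
      rw [e2]
      exact List.countP_le_length
    rw [hins]
    simp only [rankCost]
    omega
  · have : A.reverse.length ≤ outward g.right.reverse (g.size - r) := by
      refine length_le_outward (A := B.reverse) (I := I) (by rw [hl]; simp) fun hA => ?_
      have hA : A ≠ [] := by simpa using hA
      have e1 : g.elements = (g.left ++ A).flatMap Interval.bag ++
          (I :: B).flatMap Interval.bag := by
        simp [elements, intervals, hl]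
      have e2 : ((g.left ++ A).flatMap Interval.bag).countP (fun y => y.1 < e.1) =
          ((g.left ++ A).flatMap Interval.bag).length := by
        rw [List.countP_eq_length]
        intro y hy
        obtain ⟨J, hJ, hyJ⟩ := List.mem_flatMap.1 hy
        have k1 := hfar hA J hJ
        have k2 := (h5 J (by simp only [intervals, hl]; simp at hJ ⊢; tauto) y hyJ).2
        have := ext_lt_ext.1 (k2.trans_lt k1)
        simpa using this
      rw [e1, List.countP_append, e2] at hr1
      rw [e1, List.length_append] at h2
      have e3 : count (B.reverse ++ [I]) = ((I :: B).flatMap Interval.bag).length := by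
        rw [← count_reverse]
        simp [count]
      rw [e3]
      omega
    rw [List.length_reverse] at this
    rw [hins]
    simp only [rankCost]
    omega

theorem IsRank.le_length {g : Gap K V} {x : K} {r : ℕ} (h : g.IsRank x r) :
    r ≤ g.elements.length :=
  h.2.trans List.countP_le_length

end Gap

/-! ### Averaging and the expected time -/

theorem one_le_lg (x : ℝ) : 1 ≤ lg x := le_max_right _ _

theorem logb_le_lg (x : ℝ) : Real.logb 2 x ≤ lg x := le_max_left _ _

theorem lintegral_le_of_uniform {Ω : Type*} [MeasurableSpace Ω] {P : Measure Ω} {R : Ω → ℕ}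
    (hR : Measurable R) {n c : ℕ} {F : ℕ → ℕ} (hle : ∀ᵐ ω ∂P, R ω ≤ n)
    (hP : ∀ r ≤ n, P {ω | R ω = r} = ((n : ℝ≥0∞) + 1)⁻¹)
    (hF : ∑ r ∈ Finset.range (n + 1), F r ≤ c * (n + 1)) :
    ∫⁻ ω, (F (R ω) : ℝ≥0∞) ∂P ≤ c := by
  have hms : ∀ r, MeasurableSet {ω | R ω = r} := fun r => hR (measurableSet_singleton r)
  calc ∫⁻ ω, (F (R ω) : ℝ≥0∞) ∂P
      ≤ ∫⁻ ω, ∑ r ∈ Finset.range (n + 1),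
          {ω | R ω = r}.indicator (fun _ => (F r : ℝ≥0∞)) ω ∂P := by
        refine lintegral_mono_ae ?_
        filter_upwards [hle] with ω hω
        have h1 : R ω ∈ Finset.range (n + 1) := by simpa using Nat.lt_succ_of_le hω
        refine le_trans ?_ (Finset.single_le_sum (fun _ _ => zero_le) h1)
        simp
    _ = ∑ r ∈ Finset.range (n + 1), (F r : ℝ≥0∞) * ((n : ℝ≥0∞) + 1)⁻¹ := by
        rw [lintegral_finsetSum _ fun r _ => measurable_const.indicator (hms r)]
        refine Finset.sum_congr rfl fun r hr => ?_
        rw [lintegral_indicator_const (hms r), hP r (by simpa [Nat.lt_succ_iff] using hr)]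
    _ = ((∑ r ∈ Finset.range (n + 1), F r : ℕ) : ℝ≥0∞) * ((n : ℝ≥0∞) + 1)⁻¹ := by
        rw [← Finset.sum_mul, Nat.cast_sum]
    _ ≤ ((c * (n + 1) : ℕ) : ℝ≥0∞) * ((n : ℝ≥0∞) + 1)⁻¹ := by
        gcongr
    _ = c := by
        rw [Nat.cast_mul, mul_assoc, Nat.cast_add, Nat.cast_one,
          ENNReal.mul_inv_cancel (by simp) (by simp), mul_one]

namespace GapTree

variable {K : Type u} {V : Type v}

theorem level_sub_le {t : GapTree (Gap K V)} (ht : t.Biased Gap.size) {k : ℕ} {g : Gap K V}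
    (hk : (k, g) ∈ t.entries) (hg : 0 < g.size) :
    ((t.level - k : ℕ) : ℝ) ≤ lg ((t.total : ℝ) / g.size) + 1 := by
  obtain ⟨hh, -, hw, hwin⟩ := ht
  have h1 : g.size < 2 ^ k := hw _ hk
  have hn : 2 ^ t.level ≤ 2 * t.total := by
    rcases t with _ | ⟨j, l, c, r⟩
    · simp [entries] at hk
    · have := WindowsHeavy.two_pow_le (L := weights Gap.size (node j l c r).entries) hwin
        (p := (j, c.size)) (List.mem_map.2 ⟨(j, c), by simp [entries], rfl⟩)
      rwa [weightSum_weights] at this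
  rcases le_or_gt t.level k with h | h
  · rw [Nat.sub_eq_zero_of_le h, Nat.cast_zero]
    linarith [one_le_lg ((t.total : ℝ) / g.size)]
  · have h2 : 2 ^ (t.level - k) * g.size ≤ 2 * t.total := by
      refine le_trans ?_ hn
      calc 2 ^ (t.level - k) * g.size ≤ 2 ^ (t.level - k) * 2 ^ k :=
            Nat.mul_le_mul_left _ h1.le
        _ = 2 ^ t.level := by rw [← pow_add, Nat.sub_add_cancel h.le]
    have hgr : (0 : ℝ) < g.size := by exact_mod_cast hg
    have h3 : (2 : ℝ) ^ (t.level - k) * g.size ≤ 2 * t.total := by exact_mod_cast h2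
    -- The factor 2 in `2 ^ level ≤ 2 * n` becomes the `- 1` in the exponent.
    have h4 : (2 : ℝ) ^ (((t.level - k : ℕ) : ℝ) - 1) ≤ (t.total : ℝ) / g.size := by
      rw [Real.rpow_sub two_pos, Real.rpow_natCast, Real.rpow_one, le_div_iff₀ hgr]
      linarith
    have h5 : (0 : ℝ) < (t.total : ℝ) / g.size := lt_of_lt_of_le (by positivity) h4
    have h6 := (Real.le_logb_iff_rpow_le one_lt_two h5).2 h4
    linarith [logb_le_lg ((t.total : ℝ) / g.size)]

variable [LinearOrder K]

theorem insert_cost {t : GapTree (Gap K V)} (ht : IsLazySearchTree t) {g : Gap K V} {e : K × V}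
    (hloc : (t.locate e.1).1 = some g) (hg : g.WellFormed) {r : ℕ} (hr : g.IsRank e.1 r) :
    ((t.insert e).2 : ℝ) ≤ 1069 * lg ((t.total : ℝ) / g.size) + 2 * g.rankCost r := by
  obtain ⟨-, hb⟩ := ht
  obtain ⟨k, h1, h2, h3⟩ := locate_update_cost hb.1 hb.2.1 (g.insert e).1 hloc
  have h4 := ((update_updated hb.1 hb.2.1 e.1 (g.insert e).1).fixRun hb.2.1).2.2.1
  have h5 := (runsBounded_iff.1 hb.2.1).2
  have h6 := g.insert_cost hg e hr
  have hins : (t.insert e).2 = (t.locate e.1).2 + (g.insert e).2 +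
      (t.update e.1 (g.insert e).1).2 + (t.update e.1 (g.insert e).1).1.fixRun.2 := by
    simp [insert, hloc]
  simp only [maxRun] at h5
  -- Here `348 = (3 + 26) * 12`, and `373 = 348 + 21 + 4`: the run of the root, its repair, and the
  -- fixed cost inside the gap. With the level difference at most `lg + 1` and `1 ≤ lg`, the total
  -- coefficient is `348 + 348 + 373 = 1069`.
  have h7 : (t.insert e).2 ≤ 348 * (t.level - k) + 373 + 2 * g.rankCost r := by
    rw [hins]
    omega
  have h8 : ((t.insert e).2 : ℝ) ≤ 348 * ((t.level - k : ℕ) : ℝ) + 373 + 2 * g.rankCost r := by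
    exact_mod_cast h7
  have h9 := level_sub_le hb h1 hg.1
  have h10 := one_le_lg ((t.total : ℝ) / g.size)
  linarith

/-- The expected time of the insertion of an element of uniformly distributed rank. -/
theorem lintegral_insert_cost_le {t : GapTree (Gap K V)} (ht : IsLazySearchTree t) {g : Gap K V}
    (hg : g ∈ t.items) (hB : g.RuleB) {Ω : Type*} [MeasurableSpace Ω] {P : Measure Ω}
    [IsProbabilityMeasure P] {e : Ω → K × V} {R : Ω → ℕ} (hR : Measurable R)
    (hloc : ∀ᵐ ω ∂P, (t.locate (e ω).1).1 = some g)
    (hrank : ∀ᵐ ω ∂P, g.IsRank (e ω).1 (R ω))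
    (hP : ∀ r ≤ g.size, P {ω | R ω = r} = ((g.size : ℝ≥0∞) + 1)⁻¹) :
    ∫⁻ ω, ((t.insert (e ω)).2 : ℝ≥0∞) ∂P ≤
      ENNReal.ofReal (1085 * lg ((t.total : ℝ) / (g.size : ℝ))) := by
  have hwf : g.WellFormed := ht.1.2 g hg
  set x := lg ((t.total : ℝ) / (g.size : ℝ)) with hx
  have hx1 : 1 ≤ x := one_le_lg _
  have hF : ∫⁻ ω, (g.rankCost (R ω) : ℝ≥0∞) ∂P ≤ (8 : ℕ) := by
    refine lintegral_le_of_uniform hR ?_ hP (Gap.sum_rankCost_le hwf.2.1 hB)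
    filter_upwards [hrank] with ω hω
    rw [hwf.2.1]
    exact hω.le_length
  calc ∫⁻ ω, ((t.insert (e ω)).2 : ℝ≥0∞) ∂P
      ≤ ∫⁻ ω, (ENNReal.ofReal (1069 * x) + 2 * (g.rankCost (R ω) : ℝ≥0∞)) ∂P := by
        refine lintegral_mono_ae ?_
        filter_upwards [hloc, hrank] with ω h1 h2
        have h3 := ENNReal.ofReal_le_ofReal (insert_cost ht h1 hwf h2)
        rw [ENNReal.ofReal_natCast, ENNReal.ofReal_add (by positivity) (by positivity),
          ENNReal.ofReal_mul zero_le_two, ENNReal.ofReal_natCast] at h3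
        simpa using h3
    _ = ENNReal.ofReal (1069 * x) + 2 * ∫⁻ ω, (g.rankCost (R ω) : ℝ≥0∞) ∂P := by
        rw [lintegral_add_left measurable_const, lintegral_const, measure_univ, mul_one,
          lintegral_const_mul' _ _ (by simp)]
    -- The mean index bound 8 enters with factor 2; `16 ≤ 16 * x` then gives `1085 = 1069 + 16`.
    _ ≤ ENNReal.ofReal (1069 * x) + 2 * (8 : ℕ) := by gcongr
    _ = ENNReal.ofReal (1069 * x + 16) := by
        rw [ENNReal.ofReal_add (by positivity) (by norm_num)]
        norm_num
    _ ≤ ENNReal.ofReal (1085 * x) := ENNReal.ofReal_le_ofReal (by linarith)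

end GapTree

end LazySearch

open LazySearch in
theorem mainTheorem5 :
    -- every sequence of gaps can be stored in a lazy search tree
    (∀ (K : Type*) (V : Type*) [LinearOrder K] (gs : List (Gap K V)), IsGapSequence gs →
      ∃ t : GapTree (Gap K V), IsLazySearchTree t ∧ t.items = gs) ∧
    -- insertion puts the element into the gap it belongs to and yields a lazy search tree
    (∀ (K : Type*) (V : Type*) [LinearOrder K] (t : GapTree (Gap K V)), IsLazySearchTree t →
      ∀ e : K × V, IsLazySearchTree (t.insert e).1 ∧
        ∃ A g B, t.items = A ++ g :: B ∧ (t.locate e.1).1 = some g ∧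
          g.lo ≤ ext e.1 ∧ ext e.1 ≤ g.hi ∧
          (t.insert e).1.items = A ++ (g.insert e).1 :: B ∧
          (g.insert e).1.elements.Perm (e :: g.elements)) ∧
    -- expected time of insertion into the gap `g`
    ∃ C : ℝ, ∀ (K : Type*) (V : Type*) [LinearOrder K] (t : GapTree (Gap K V)),
      IsLazySearchTree t → ∀ g ∈ t.items, g.RuleA → g.RuleB →
      ∀ (Ω : Type*) [MeasurableSpace Ω] (P : Measure Ω) [IsProbabilityMeasure P]
        (e : Ω → K × V) (R : Ω → ℕ),
        (∀ a : K, MeasurableSet {ω | (e ω).1 ≤ a} ∧ MeasurableSet {ω | a ≤ (e ω).1}) →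
        Measurable R →
        (∀ᵐ ω ∂P, (t.locate (e ω).1).1 = some g) →
        (∀ᵐ ω ∂P, g.IsRank (e ω).1 (R ω)) →
        (∀ r ≤ g.size, P {ω | R ω = r} = ((g.size : ℝ≥0∞) + 1)⁻¹) →
        ∫⁻ ω, ((t.insert (e ω)).2 : ℝ≥0∞) ∂P ≤
          ENNReal.ofReal (C * lg ((t.total : ℝ) / (g.size : ℝ))) := by
  refine ⟨?_, ?_, 1085, ?_⟩
  · intro K V _ gs hgs
    obtain ⟨t, h1, h2⟩ := GapTree.exists_biased Gap.size gs fun g hg => (hgs.2 g hg).1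
    exact ⟨t, ⟨h2.symm ▸ hgs, h1⟩, h2⟩
  · intro K V _ t ht e
    exact GapTree.insert_spec ht e
  · intro K V _ t ht g hg _ hB Ω _ P _ e R _ hR hloc hrank hP
    exact GapTree.lintegral_insert_cost_le ht hg hB hR hloc hrank hP
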